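/- Let $\mathbb K$ be a field of characteristic $0$. **2-term Leibniz infinity algebras.** A 2-term Leibniz infinity algebra is a graded vector space $V=V_0\oplus V_1$ with a linear, a bilinear and a trilinear map $l_1,l_2,l_3$ on $V$ of degrees $-1,0,1$ such that, for $w,x,y,z\in V_0$ and $h,k\in V_1$: $l_1l_2(x,h)=l_2(x,l_1h)$, $l_1l_2(h,x)=l_2(l_1h,x)$; $l_2(l_1h,k)=l_2(h,l_1k)$; $l_1l_3(x,y,z)=J(x,y,z)$, $l_3(x,y,l_1h)=J(x,y,h)$, $l_3(x,l_1h,y)=J(x,h,y)$, $l_3(l_1h,x,y)=J(h,x,y)$, where $J(a,b,c)=l_2(a,l_2(b,c))-l_2(b,l_2(a,c))-l_2(l_2(a,b),c)$; and $$l_2(l_3(w,x,y),z)+l_2(w,l_3(x,y,z))-l_2(x,l_3(w,y,z))+l_2(y,l_3(w,x,z))-l_3(l_2(w,x),y,z)+l_3(w,l_2(x,y),z)-l_3(x,l_2(w,y),z)-l_3(w,x,l_2(y,z))+l_3(w,y,l_2(x,z))-l_3(x,y,l_2(w,z))=0.$$ An infinity morphism $f=(f_1,f_2)$ from $(V,l_i)$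 to $(W,m_i)$ is a linear map $f_1$ and a bilinear map $f_2$ from $V$ to $W$ of degrees $0$ and $1$ with $m_1f_1h=f_1l_1h$; $m_2(f_1x,f_1y)+m_1f_2(x,y)=f_1l_2(x,y)$; $m_2(f_1x,f_1h)=f_1l_2(x,h)-f_2(x,l_1h)$; $m_2(f_1h,f_1x)=f_1l_2(h,x)-f_2(l_1h,x)$; and $$m_3(f_1x,f_1y,f_1z)-m_2(f_2(x,y),f_1z)+m_2(f_1x,f_2(y,z))-m_2(f_1y,f_2(x,z))=f_1l_3(x,y,z)+f_2(l_2(x,y),z)-f_2(x,l_2(y,z))+f_2(y,l_2(x,z)).$$ **2-term $\infty$-homotopies.** A 2-term $\infty$-homotopy from $f$ to $g$ (infinity morphisms $V\to W$) is a linear map $\theta_1:V\to W$ of degree $1$ such that, for $x,y\in V_0$, $h\in V_1$: (a) $g_1x-f_1x=m_1\theta_1x$; (b) $g_1h-f_1h=\theta_1l_1h$; (c) $g_2(x,y)-f_2(x,y)=\theta_1l_2(x,y)-m_2(f_1x,\theta_1y)-m_2(\theta_1x,g_1y)$. Let $\mathcal T(f,g)$ be the set of these and $\mathcal T=\bigsqcup_{f,g}\mathcal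 T(f,g)$. **$\infty$-homotopies.** Let $\mathrm{Zin}^c(sV)$ be the reduced tensor module of $sV$ with the Zinbiel coproduct $\Delta(v_1\cdots v_p)=\sum_{k=1}^{p-1}\sum_{\sigma\in \mathrm{Sh}(k,p-k-1)}\varepsilon(\sigma)\,v_{\sigma(1)}\cdots v_{\sigma(k)}\otimes v_{\sigma(k+1)}\cdots v_{\sigma(p-1)}v_p$, and with the coderivation $D$ of degree $-1$ whose corestrictions $D_i$ are given by $l_i=s^{-1}D_is^{\otimes i}$. The convolution Lie infinity algebra $L=L(V,W)=\mathrm{Hom}_{\mathbb K}(\mathrm{Zin}^c(sV),W)$ has the brackets $\mathcal L_1f=m_1f+(-1)^{|f|}fD$ and, for $p\ge2$, $\mathcal L_p(f_1,\dots,f_p)=m_p\circ\big(\sum_{\sigma\in S_p}\varepsilon(\sigma)\,\mathrm{sign}(\sigma)\,f_{\sigma(1)}\otimes\cdots\otimes f_{\sigma(p)}\big)\circ\Delta^{p-1}$, where $\Delta^{p-1}=(\Delta\otimes\mathrm{id}^{\otimes(p-2)})\cdots(\Delta\otimes\mathrm{id})\Delta$ (these brackets vanish for $p\ge4$). Let $\Omega_1=\mathbb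 K[t]\oplus\mathbb K[t]\,dt$ be the algebra of polynomial differential forms on $\Delta^1$, with forms negatively graded, and extend the brackets to $\bar L=L\otimes\Omega_1$: $\bar{\mathcal L}_1(f\otimes\omega)=\mathcal L_1f\otimes\omega+(-1)^{|f|}f\otimes d\omega$ and $\bar{\mathcal L}_p(f_1\otimes\omega_1,\dots,f_p\otimes\omega_p)=\pm\mathcal L_p(f_1,\dots,f_p)\otimes\omega_1\cdots\omega_p$, with the Koszul sign. An $\infty$-homotopy is an element $\alpha\in\bar L$ of degree $-1$ with $\sum_{p\ge1}\frac1{p!}(-1)^{p(p-1)/2}\bar{\mathcal L}_p(\alpha,\dots,\alpha)=0$. Let $\mathcal I$ be the set of these. For $i\in\{0,1\}$ let $\varepsilon_1^i:\bar L\to L$ be the evaluation at $t=i$. An infinity morphism $f$ is identified with the element of degree $-1$ of $L$ with components $f_1s^{-1}$ and $f_2(s\otimes s)^{-1}$ on words of length $1$ and $2$ and $0$ on longer words; let $\mathcal I(f,g)=\{\alpha\in\mathcal I:\varepsilon_1^0\alpha=f,\ \varepsilon_1^1\alpha=g\}$. Finally let $h_1^i:\bar L\to\bar L$ be the (Koszul-signed)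 extension of the operator on $\Omega_1$ that sends $a(t)+b(t)\,dt$ to $\int_i^tb(u)\,du$. **Theorem.** Let $V,W$ be 2-term Leibniz infinity algebras over $\mathbb K$ and let $i\in\{0,1\}$. Every $\alpha\in\mathcal I$ belongs to $\mathcal I(f,g)$ for unique infinity morphisms $f,g:V\to W$, and then, with $\beta=h_1^i\alpha$, the map $$S_1^i\alpha:=(\varepsilon_1^1\beta-\varepsilon_1^0\beta)\,s:V\to W$$ is a 2-term $\infty$-homotopy from $f$ to $g$. The resulting map $S_1^i:\mathcal I\to\mathcal T$ is surjective and preserves source and target: for all $f,g$ it restricts to a surjection $\mathcal I(f,g)\to\mathcal T(f,g)$. -/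

import Mathlib

open scoped TensorProduct Polynomial

namespace LeibInf

noncomputable section

/-! ### 2-term Leibniz infinity algebras, their morphisms and their 2-term homotopies -/

/-- A 2-term Leibniz infinity algebra on the graded vector space `V₀ ⊕ V₁`. The bilinear map of
degree `0` has the components `l₂ : V₀ × V₀ → V₀`, `l₂r : V₀ × V₁ → V₁`, `l₂l : V₁ × V₀ → V₁`
(its component on `V₁ × V₁` takes values in degree `2`, hence vanishes). -/
structure TwoTermLeibniz (K V₀ V₁ : Type*) [Field K] [AddCommGroup V₀] [Module K V₀]
    [AddCommGroup V₁] [Module K V₁] where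
  l₁ : V₁ →ₗ[K] V₀
  l₂ : V₀ →ₗ[K] V₀ →ₗ[K] V₀
  l₂r : V₀ →ₗ[K] V₁ →ₗ[K] V₁
  l₂l : V₁ →ₗ[K] V₀ →ₗ[K] V₁
  l₃ : V₀ →ₗ[K] V₀ →ₗ[K] V₀ →ₗ[K] V₁
  rel_a₁ : ∀ x h, l₁ (l₂r x h) = l₂ x (l₁ h)
  rel_a₂ : ∀ h x, l₁ (l₂l h x) = l₂ (l₁ h) x
  rel_b : ∀ h k, l₂r (l₁ h) k = l₂l h (l₁ k)
  rel_c : ∀ x y z, l₁ (l₃ x y z) = l₂ x (l₂ y z) - l₂ y (l₂ x z) - l₂ (l₂ x y) z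
  rel_d₁ : ∀ x y h, l₃ x y (l₁ h) = l₂r x (l₂r y h) - l₂r y (l₂r x h) - l₂r (l₂ x y) h
  rel_d₂ : ∀ x h y, l₃ x (l₁ h) y = l₂r x (l₂l h y) - l₂l h (l₂ x y) - l₂l (l₂r x h) y
  rel_d₃ : ∀ h x y, l₃ (l₁ h) x y = l₂l h (l₂ x y) - l₂r x (l₂l h y) - l₂l (l₂l h x) y
  rel_e : ∀ w x y z,
    l₂l (l₃ w x y) z + l₂r w (l₃ x y z) - l₂r x (l₃ w y z) + l₂r y (l₃ w x z)
      - l₃ (l₂ w x) y z + l₃ w (l₂ x y) z - l₃ x (l₂ w y) z - l₃ w x (l₂ y z)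
      + l₃ w y (l₂ x z) - l₃ x y (l₂ w z) = 0

section Spaces

variable {K V₀ V₁ W₀ W₁ : Type*} [Field K]
  [AddCommGroup V₀] [Module K V₀] [AddCommGroup V₁] [Module K V₁]
  [AddCommGroup W₀] [Module K W₀] [AddCommGroup W₁] [Module K W₁]

/-- An infinity morphism `(f₁, f₂)` between 2-term Leibniz infinity algebras; `f₁` has the
components `f₁₀ : V₀ → W₀` and `f₁₁ : V₁ → W₁`, and `f₂ : V₀ × V₀ → W₁`. -/
structure InfMorphism (V : TwoTermLeibniz K V₀ V₁) (W : TwoTermLeibniz K W₀ W₁) where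
  f₁₀ : V₀ →ₗ[K] W₀
  f₁₁ : V₁ →ₗ[K] W₁
  f₂ : V₀ →ₗ[K] V₀ →ₗ[K] W₁
  rel_a : ∀ h, W.l₁ (f₁₁ h) = f₁₀ (V.l₁ h)
  rel_b : ∀ x y, W.l₂ (f₁₀ x) (f₁₀ y) + W.l₁ (f₂ x y) = f₁₀ (V.l₂ x y)
  rel_c₁ : ∀ x h, W.l₂r (f₁₀ x) (f₁₁ h) = f₁₁ (V.l₂r x h) - f₂ x (V.l₁ h)
  rel_c₂ : ∀ h x, W.l₂l (f₁₁ h) (f₁₀ x) = f₁₁ (V.l₂l h x) - f₂ (V.l₁ h) x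
  rel_d : ∀ x y z,
    W.l₃ (f₁₀ x) (f₁₀ y) (f₁₀ z) - W.l₂l (f₂ x y) (f₁₀ z) + W.l₂r (f₁₀ x) (f₂ y z)
        - W.l₂r (f₁₀ y) (f₂ x z)
      = f₁₁ (V.l₃ x y z) + f₂ (V.l₂ x y) z - f₂ x (V.l₂ y z) + f₂ y (V.l₂ x z)

/-- A 2-term infinity homotopy, with its source `f` and its target `g`. A linear map of degree `1`
from `V₀ ⊕ V₁` to `W₀ ⊕ W₁` is the same as a linear map `V₀ → W₁`. -/
structure TwoTermHomotopy (V : TwoTermLeibniz K V₀ V₁) (W : TwoTermLeibniz K W₀ W₁) where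
  f : InfMorphism V W
  g : InfMorphism V W
  θ : V₀ →ₗ[K] W₁
  rel_a : ∀ x, g.f₁₀ x - f.f₁₀ x = W.l₁ (θ x)
  rel_b : ∀ h, g.f₁₁ h - f.f₁₁ h = θ (V.l₁ h)
  rel_c : ∀ x y, g.f₂ x y - f.f₂ x y
    = θ (V.l₂ x y) - W.l₂r (f.f₁₀ x) (θ y) - W.l₂l (θ x) (g.f₁₀ y)

end Spaces

/-! ### Primitive recursion on words -/

section Rec

variable {K M X : Type*} [Field K] [AddCommGroup M] [Module K M] [AddCommGroup X] [Module K X]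

/-- Auxiliary to `tRec`: the action of a letter on pairs (word, value). -/
def stepEnd (s : M →ₗ[K] (TensorAlgebra K M × X →ₗ[K] X)) :
    M →ₗ[K] Module.End K (TensorAlgebra K M × X) :=
  LinearMap.mk₂ K (fun v p => (TensorAlgebra.ι K v * p.1, s v p))
    (by intros; simp [add_mul]) (by intros; simp) (by intros; simp [mul_add]) (by intros; simp)

/-- The linear map `F` on the tensor algebra with `F 1 = x₀` and `F (v w) = s v (w, F w)` for a
letter `v` and a word `w`. -/
def tRec (x₀ : X) (s : M →ₗ[K] (TensorAlgebra K M × X →ₗ[K] X)) : TensorAlgebra K M →ₗ[K] X :=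
  LinearMap.snd K _ _ ∘ₗ LinearMap.applyₗ (R := K) ((1 : TensorAlgebra K M), x₀) ∘ₗ
    (TensorAlgebra.lift K (stepEnd s)).toLinearMap

theorem stepEnd_fst (s : M →ₗ[K] (TensorAlgebra K M × X →ₗ[K] X)) (a : TensorAlgebra K M)
    (p : TensorAlgebra K M × X) : (TensorAlgebra.lift K (stepEnd s) a p).1 = a * p.1 := by
  induction a using TensorAlgebra.induction generalizing p with
  | algebraMap r => simp [Algebra.smul_def, Module.algebraMap_end_apply]
  | ι x => simp [stepEnd]
  | mul a b ha hb => simp [ha, hb, mul_assoc]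
  | add a b ha hb => simp [ha, hb, add_mul]

theorem tRec_one (x₀ : X) (s : M →ₗ[K] (TensorAlgebra K M × X →ₗ[K] X)) :
    tRec x₀ s 1 = x₀ := by
  simp [tRec]

theorem tRec_ι_mul (x₀ : X) (s : M →ₗ[K] (TensorAlgebra K M × X →ₗ[K] X)) (v : M)
    (w : TensorAlgebra K M) : tRec x₀ s (TensorAlgebra.ι K v * w) = s v (w, tRec x₀ s w) := by
  have h := stepEnd_fst s w (1, x₀)
  simp only [mul_one] at h
  simp only [tRec, LinearMap.comp_apply, AlgHom.toLinearMap_apply, map_mul, Module.End.mul_apply,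
    LinearMap.applyₗ_apply_apply, TensorAlgebra.lift_ι_apply]
  conv_lhs => rw [stepEnd, LinearMap.mk₂_apply]
  simp only [LinearMap.snd_apply]
  congr 1
  exact Prod.ext h rfl

end Rec

/-! ### The cofree Zinbiel coalgebra on `sV` -/

section Zinbiel

variable (K V₀ V₁ : Type*) [Field K] [AddCommGroup V₀] [Module K V₀] [AddCommGroup V₁] [Module K V₁]

/-- The tensor module `T(sV)`, `V = V₀ ⊕ V₁`; the letter `ι (x, h)` is the suspended vector
`s(x + h)`, so that `ι (x, 0)` has degree `1` and `ι (0, h)` has degree `2`. The space underlying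
`Zin^c(sV)` is its subspace spanned by the nonempty words. All structure maps below are extended by
`0` to the empty word `1`. -/
abbrev Tens := TensorAlgebra K (V₀ × V₁)

variable {K V₀ V₁}

/-- The letter of `sV` given by a homogeneous vector of `V`. -/
def letter : V₀ ⊕ V₁ → Tens K V₀ V₁
  | .inl x => TensorAlgebra.ι K (x, 0)
  | .inr h => TensorAlgebra.ι K (0, h)

/-- The word in `T(sV)` given by a list of homogeneous vectors of `V`. -/
def word (l : List (V₀ ⊕ V₁)) : Tens K V₀ V₁ := (l.map letter).prod

/-- The degree of a homogeneous letter of `sV`. -/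
def letterDeg : V₀ ⊕ V₁ → ℤ
  | .inl _ => 1
  | .inr _ => 2

/-- The degree of a word in homogeneous letters of `sV`. -/
def wordDeg (l : List (V₀ ⊕ V₁)) : ℤ := (l.map letterDeg).sum

/-- The Koszul sign operator `w ↦ (-1)^(k|w|) w` on `T(sV)`. -/
def koszul (k : ℤ) : Tens K V₀ V₁ →ₐ[K] Tens K V₀ V₁ :=
  TensorAlgebra.lift K (TensorAlgebra.ι K ∘ₗ
    LinearMap.prodMap (((-1 : K) ^ k) • LinearMap.id) LinearMap.id)

/-- The projection of `T(sV)` onto the span of the nonempty words. -/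
def red : Tens K V₀ V₁ →ₗ[K] Tens K V₀ V₁ :=
  LinearMap.id - Algebra.linearMap K _ ∘ₗ TensorAlgebra.algebraMapInv.toLinearMap

/-- The Zinbiel coproduct `Δ` of `Zin^c(sV)`,
`Δ(v₁…v_p) = ∑_{1 ≤ k < p} ∑_{σ ∈ Sh(k,p-k-1)} ε(σ) v_{σ(1)}…v_{σ(k)} ⊗ v_{σ(k+1)}…v_{σ(p-1)} v_p`,
written as a recursion on the first letter: for a nonempty word `w`,
`Δ(v w) = v ⊗ w + (v ⊗ 1) Δ(w) + (1 ⊗ v) Δ(w)`, where `(1 ⊗ v)(a ⊗ b) = (-1)^(|v||a|) a ⊗ v b`. -/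
def coprod : Tens K V₀ V₁ →ₗ[K] Tens K V₀ V₁ ⊗[K] Tens K V₀ V₁ :=
  tRec 0 (LinearMap.mk₂ K
    (fun v p => TensorAlgebra.ι K v ⊗ₜ[K] red p.1
      + TensorProduct.map (LinearMap.mul K _ (TensorAlgebra.ι K v)) LinearMap.id p.2
      + TensorProduct.map (koszul 1).toLinearMap
          (LinearMap.mul K _ (TensorAlgebra.ι K (LinearMap.inl K V₀ V₁ v.1))) p.2
      + TensorProduct.map LinearMap.id
          (LinearMap.mul K _ (TensorAlgebra.ι K (LinearMap.inr K V₀ V₁ v.2))) p.2)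
    (by
      intro u v p
      simp only [map_add, Prod.fst_add, Prod.snd_add, TensorProduct.add_tmul,
        TensorProduct.map_add_left, TensorProduct.map_add_right, LinearMap.add_apply]
      abel)
    (by
      intro c v p
      simp only [map_smul, Prod.smul_fst, Prod.smul_snd, TensorProduct.smul_tmul',
        TensorProduct.map_smul_left, TensorProduct.map_smul_right, LinearMap.smul_apply, smul_add])
    (by
      intro v p q
      simp only [map_add, Prod.fst_add, Prod.snd_add, TensorProduct.tmul_add]
      abel)
    (by
      intro c v p
      simp only [map_smul, Prod.smul_fst, Prod.smul_snd, TensorProduct.tmul_smul, smul_add]))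

/-- The coproduct `Δ` with the additional terms `1 ⊗ w`, `w` a nonempty word, i.e. the same sum with
`0 ≤ k < p`. -/
def coprodPlus : Tens K V₀ V₁ →ₗ[K] Tens K V₀ V₁ ⊗[K] Tens K V₀ V₁ :=
  coprod + TensorProduct.mk K _ _ 1 ∘ₗ red

/-- Deconcatenation `v₁…v_n ↦ ∑_{0 ≤ k ≤ n} v₁…v_k ⊗ v_{k+1}…v_n`. -/
def deconc : Tens K V₀ V₁ →ₗ[K] Tens K V₀ V₁ ⊗[K] Tens K V₀ V₁ :=
  tRec (1 ⊗ₜ[K] 1) (LinearMap.mk₂ K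
    (fun v p => 1 ⊗ₜ[K] (TensorAlgebra.ι K v * p.1)
      + TensorProduct.map (LinearMap.mul K _ (TensorAlgebra.ι K v)) LinearMap.id p.2)
    (by
      intro u v p
      simp only [map_add, add_mul, TensorProduct.tmul_add, TensorProduct.map_add_left,
        LinearMap.add_apply]
      abel)
    (by
      intro c v p
      simp only [map_smul, smul_mul_assoc, TensorProduct.tmul_smul, TensorProduct.map_smul_left,
        LinearMap.smul_apply, smul_add])
    (by
      intro v p q
      simp only [map_add, Prod.fst_add, Prod.snd_add, mul_add, TensorProduct.tmul_add]
      abel)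
    (by
      intro c v p
      simp only [map_smul, Prod.smul_fst, Prod.smul_snd, mul_smul_comm, TensorProduct.tmul_smul,
        smul_add]))

/-- The projection of `T(sV)` onto words of length `1`. -/
def proj₁ : Tens K V₀ V₁ →ₗ[K] V₀ × V₁ :=
  tRec 0 (LinearMap.mk₂ K (fun v p => TensorAlgebra.algebraMapInv p.1 • v)
    (by intros; simp) (by intro c v p; exact smul_comm _ _ _) (by intros; simp [add_smul])
    (by intros; simp [mul_smul]))

/-- The projection of `T(sV)` onto words of length `2`. -/
def proj₂ : Tens K V₀ V₁ →ₗ[K] (V₀ × V₁) ⊗[K] (V₀ × V₁) :=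
  tRec 0 (LinearMap.mk₂ K (fun v p => v ⊗ₜ[K] proj₁ p.1)
    (by intros; simp [TensorProduct.add_tmul]) (by intros; simp [TensorProduct.smul_tmul'])
    (by intros; simp [TensorProduct.tmul_add]) (by intros; simp))

/-- The projection of `T(sV)` onto words of length `3`. -/
def proj₃ : Tens K V₀ V₁ →ₗ[K] (V₀ × V₁) ⊗[K] ((V₀ × V₁) ⊗[K] (V₀ × V₁)) :=
  tRec 0 (LinearMap.mk₂ K (fun v p => v ⊗ₜ[K] proj₂ p.1)
    (by intros; simp [TensorProduct.add_tmul]) (by intros; simp [TensorProduct.smul_tmul'])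
    (by intros; simp [TensorProduct.tmul_add]) (by intros; simp))

/-- The operator `v ↦ (-1)^|v| v` on `V = V₀ ⊕ V₁`. -/
def parity : V₀ × V₁ →ₗ[K] V₀ × V₁ := LinearMap.prodMap LinearMap.id (-LinearMap.id)

/-- The homogeneous component of degree `n` of `V = V₀ ⊕ V₁`. -/
def gr (K V₀ V₁ : Type*) [Field K] [AddCommGroup V₀] [Module K V₀] [AddCommGroup V₁] [Module K V₁]
    (n : ℤ) : Submodule K (V₀ × V₁) where
  carrier := {v | (n ≠ 0 → v.1 = 0) ∧ (n ≠ 1 → v.2 = 0)}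
  add_mem' := by
    rintro a b ⟨h₁, h₂⟩ ⟨h₃, h₄⟩
    exact ⟨fun h => by simp [h₁ h, h₃ h], fun h => by simp [h₂ h, h₄ h]⟩
  zero_mem' := by simp
  smul_mem' := by
    rintro c a ⟨h₁, h₂⟩
    exact ⟨fun h => by simp [h₁ h], fun h => by simp [h₂ h]⟩

namespace TwoTermLeibniz

variable (V : TwoTermLeibniz K V₀ V₁)

/-- The structure map `l₁` on `V = V₀ ⊕ V₁`. -/
def t₁ : V₀ × V₁ →ₗ[K] V₀ × V₁ := LinearMap.inl K V₀ V₁ ∘ₗ V.l₁ ∘ₗ LinearMap.snd K V₀ V₁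

/-- The structure map `l₂` on `V = V₀ ⊕ V₁`. -/
def t₂ : (V₀ × V₁) ⊗[K] (V₀ × V₁) →ₗ[K] V₀ × V₁ :=
  TensorProduct.lift (LinearMap.mk₂ K
    (fun u v => (V.l₂ u.1 v.1, V.l₂r u.1 v.2 + V.l₂l u.2 v.1))
    (by intros; simp; abel) (by intros; simp) (by intros; simp; abel) (by intros; simp))

/-- The structure map `l₃` on `V = V₀ ⊕ V₁`. -/
def t₃ : (V₀ × V₁) ⊗[K] ((V₀ × V₁) ⊗[K] (V₀ × V₁)) →ₗ[K] V₀ × V₁ :=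
  LinearMap.inr K V₀ V₁ ∘ₗ
    TensorProduct.lift (TensorProduct.uncurry (RingHom.id K) V₀ V₀ V₁ ∘ₗ V.l₃) ∘ₗ
    TensorProduct.map (LinearMap.fst K V₀ V₁)
      (TensorProduct.map (LinearMap.fst K V₀ V₁) (LinearMap.fst K V₀ V₁))

/-- The corestriction `D₁ + D₂ + D₃ : Zin^c(sV) → sV` of the codifferential, where
`l_i = s⁻¹ D_i s^{⊗ i}`, i.e. `D₁(su) = s l₁(u)`, `D₂(su, sv) = (-1)^|u| s l₂(u, v)` and
`D₃(su, sv, sw) = (-1)^|v| s l₃(u, v, w)` (where `l₃` vanishes unless `|v| = 0`). -/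
def corestr : Tens K V₀ V₁ →ₗ[K] V₀ × V₁ :=
  V.t₁ ∘ₗ proj₁ + V.t₂ ∘ₗ TensorProduct.map parity LinearMap.id ∘ₗ proj₂ + V.t₃ ∘ₗ proj₃

/-- The codifferential of `Zin^c(sV)`, i.e. the coderivation of degree `-1` with the given
corestriction:
`D(v₁…v_n) = ∑_k ∑_j ∑_{σ ∈ Sh(k-j,j-1)} ε(σ) (-1)^{|v_{σ(1)}| + ⋯ + |v_{σ(k-j)}|}
  v_{σ(1)}…v_{σ(k-j)} D_j(v_{σ(k-j+1)},…,v_{σ(k-1)},v_k) v_{k+1}…v_n`. -/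
def codiff : Tens K V₀ V₁ →ₗ[K] Tens K V₀ V₁ :=
  LinearMap.mul' K _ ∘ₗ
    TensorProduct.map
      (LinearMap.mul' K _ ∘ₗ
        TensorProduct.map (koszul (-1)).toLinearMap (TensorAlgebra.ι K ∘ₗ V.corestr) ∘ₗ coprodPlus)
      LinearMap.id ∘ₗ
    deconc

end TwoTermLeibniz

end Zinbiel

/-! ### The convolution Lie infinity algebra `L(V, W) = Hom(Zin^c(sV), W)` -/

section Convolution

variable {K V₀ V₁ W₀ W₁ : Type*} [Field K]
  [AddCommGroup V₀] [Module K V₀] [AddCommGroup V₁] [Module K V₁]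
  [AddCommGroup W₀] [Module K W₀] [AddCommGroup W₁] [Module K W₁]

variable (K V₀ V₁ W₀ W₁) in
/-- Linear maps `T(sV) → W`. -/
abbrev THom := Tens K V₀ V₁ →ₗ[K] W₀ × W₁

variable (K V₀ V₁ W₀ W₁) in
/-- The component `L_k` of degree `k` of `L = Hom(Zin^c(sV), W)`: the linear maps that raise the
degree by `k`. A linear map on `Zin^c(sV)` is identified with the linear map on `T(sV)` that extends
it by `0` to the empty word. -/
def convDeg (k : ℤ) : Submodule K (THom K V₀ V₁ W₀ W₁) where
  carrier := {f | f 1 = 0 ∧ ∀ l : List (V₀ ⊕ V₁), f (word l) ∈ gr K W₀ W₁ (wordDeg l + k)}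
  add_mem' := by
    rintro a b ⟨h₁, h₂⟩ ⟨h₃, h₄⟩
    exact ⟨by simp [h₁, h₃], fun l => Submodule.add_mem _ (h₂ l) (h₄ l)⟩
  zero_mem' := ⟨by simp, fun l => Submodule.zero_mem _⟩
  smul_mem' := by
    rintro c a ⟨h₁, h₂⟩
    exact ⟨by simp [h₁], fun l => Submodule.smul_mem _ c (h₂ l)⟩

/-- `(f₁ ⊗ f₂) ∘ Δ`, for `f₂` of degree `k₂`, where
`(f₁ ⊗ f₂)(a ⊗ b) = (-1)^(k₂|a|) f₁(a) ⊗ f₂(b)`. -/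
def conv₂ (k₂ : ℤ) : THom K V₀ V₁ W₀ W₁ →ₗ[K] THom K V₀ V₁ W₀ W₁ →ₗ[K]
    (Tens K V₀ V₁ →ₗ[K] (W₀ × W₁) ⊗[K] (W₀ × W₁)) :=
  LinearMap.mk₂ K
    (fun f₁ f₂ => TensorProduct.map (f₁ ∘ₗ (koszul k₂).toLinearMap) f₂ ∘ₗ coprod)
    (by intros; simp only [LinearMap.add_comp, TensorProduct.map_add_left])
    (by intros; simp only [LinearMap.smul_comp, TensorProduct.map_smul_left])
    (by intros; simp only [LinearMap.add_comp, TensorProduct.map_add_right])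
    (by intros; simp only [LinearMap.smul_comp, TensorProduct.map_smul_right])

/-- `(f₁ ⊗ f₂ ⊗ f₃) ∘ Δ²`, for `f₂` of degree `k₂` and `f₃` of degree `k₃`, where
`Δ² = (Δ ⊗ id) ∘ Δ` and
`(f₁ ⊗ f₂ ⊗ f₃)(a ⊗ b ⊗ c) = (-1)^(k₂|a| + k₃(|a| + |b|)) f₁(a) ⊗ f₂(b) ⊗ f₃(c)`. -/
def conv₃ (k₂ k₃ : ℤ) : THom K V₀ V₁ W₀ W₁ →ₗ[K] THom K V₀ V₁ W₀ W₁ →ₗ[K]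
    THom K V₀ V₁ W₀ W₁ →ₗ[K]
    (Tens K V₀ V₁ →ₗ[K] (W₀ × W₁) ⊗[K] ((W₀ × W₁) ⊗[K] (W₀ × W₁))) :=
  LinearMap.mk₂ K
    (fun f₁ f₂ =>
      { toFun := fun f₃ => (TensorProduct.assoc K _ _ _).toLinearMap ∘ₗ
          TensorProduct.map (conv₂ k₂ f₁ f₂ ∘ₗ (koszul k₃).toLinearMap) f₃ ∘ₗ coprod
        map_add' := by
          intros
          simp only [LinearMap.add_comp, LinearMap.comp_add, TensorProduct.map_add_right]
        map_smul' := by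
          intros
          simp only [LinearMap.smul_comp, LinearMap.comp_smul, TensorProduct.map_smul_right,
            RingHom.id_apply] })
    (by
      intros; ext1
      simp only [map_add, LinearMap.add_apply, LinearMap.add_comp, LinearMap.comp_add,
        TensorProduct.map_add_left, LinearMap.coe_mk, AddHom.coe_mk])
    (by
      intros; ext1
      simp only [map_smul, LinearMap.smul_apply, LinearMap.smul_comp, LinearMap.comp_smul,
        TensorProduct.map_smul_left, LinearMap.coe_mk, AddHom.coe_mk])
    (by
      intros; ext1
      simp only [map_add, LinearMap.add_apply, LinearMap.add_comp, LinearMap.comp_add,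
        TensorProduct.map_add_left, LinearMap.coe_mk, AddHom.coe_mk])
    (by
      intros; ext1
      simp only [map_smul, LinearMap.smul_apply, LinearMap.smul_comp, LinearMap.comp_smul,
        TensorProduct.map_smul_left, LinearMap.coe_mk, AddHom.coe_mk])

/-- The convolution bracket `𝓛₁ f = m₁ ∘ f + (-1)^k f ∘ D` on elements of degree `k`. -/
def bracket₁ (V : TwoTermLeibniz K V₀ V₁) (W : TwoTermLeibniz K W₀ W₁) (k : ℤ) :
    THom K V₀ V₁ W₀ W₁ →ₗ[K] THom K V₀ V₁ W₀ W₁ :=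
  LinearMap.llcomp K _ _ _ W.t₁ + ((-1 : K) ^ k) • LinearMap.lcomp K _ V.codiff

/-- The sum `∑_σ ε(σ) sign(σ) f_{σ(1)} ⊗ f_{σ(2)} ∘ Δ` over the two permutations `σ`, for elements of
degrees `k₁`, `k₂`. -/
def antisymm₂ (k₁ k₂ : ℤ) : THom K V₀ V₁ W₀ W₁ →ₗ[K] THom K V₀ V₁ W₀ W₁ →ₗ[K]
    (Tens K V₀ V₁ →ₗ[K] (W₀ × W₁) ⊗[K] (W₀ × W₁)) :=
  LinearMap.mk₂ K
    (fun f₁ f₂ => conv₂ k₂ f₁ f₂ - ((-1 : K) ^ (k₁ * k₂)) • conv₂ k₁ f₂ f₁)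
    (by intros; simp only [map_add, LinearMap.add_apply]; module)
    (by intros; simp only [map_smul, LinearMap.smul_apply]; module)
    (by intros; simp only [map_add, LinearMap.add_apply]; module)
    (by intros; simp only [map_smul, LinearMap.smul_apply]; module)

/-- The convolution bracket `𝓛₂ (f₁, f₂) = m₂ ∘ ∑_σ ε(σ) sign(σ) f_{σ(1)} ⊗ f_{σ(2)} ∘ Δ` on elements
of degrees `k₁`, `k₂`. -/
def bracket₂ (W : TwoTermLeibniz K W₀ W₁) (k₁ k₂ : ℤ) :
    THom K V₀ V₁ W₀ W₁ →ₗ[K] THom K V₀ V₁ W₀ W₁ →ₗ[K] THom K V₀ V₁ W₀ W₁ :=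
  (antisymm₂ k₁ k₂).compr₂ (LinearMap.llcomp K _ _ _ W.t₂)

/-- The sum `∑_σ ε(σ) sign(σ) f_{σ(1)} ⊗ f_{σ(2)} ⊗ f_{σ(3)} ∘ Δ²` over the six permutations `σ`, for
elements of degrees `k₁`, `k₂`, `k₃`. -/
def antisymm₃ (k₁ k₂ k₃ : ℤ) : THom K V₀ V₁ W₀ W₁ →ₗ[K] THom K V₀ V₁ W₀ W₁ →ₗ[K]
    THom K V₀ V₁ W₀ W₁ →ₗ[K]
    (Tens K V₀ V₁ →ₗ[K] (W₀ × W₁) ⊗[K] ((W₀ × W₁) ⊗[K] (W₀ × W₁))) :=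
  LinearMap.mk₂ K
    (fun f₁ f₂ =>
      { toFun := fun f₃ => conv₃ k₂ k₃ f₁ f₂ f₃
          - ((-1 : K) ^ (k₁ * k₂)) • conv₃ k₁ k₃ f₂ f₁ f₃
          - ((-1 : K) ^ (k₂ * k₃)) • conv₃ k₃ k₂ f₁ f₃ f₂
          + ((-1 : K) ^ (k₁ * k₂ + k₁ * k₃)) • conv₃ k₃ k₁ f₂ f₃ f₁
          + ((-1 : K) ^ (k₁ * k₃ + k₂ * k₃)) • conv₃ k₁ k₂ f₃ f₁ f₂
          - ((-1 : K) ^ (k₁ * k₂ + k₁ * k₃ + k₂ * k₃)) • conv₃ k₂ k₁ f₃ f₂ f₁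
        map_add' := by
          intros
          simp only [map_add, LinearMap.add_apply]
          module
        map_smul' := by
          intros
          simp only [map_smul, LinearMap.smul_apply, RingHom.id_apply]
          module })
    (by
      intros; ext1
      simp only [map_add, LinearMap.add_apply, LinearMap.coe_mk, AddHom.coe_mk]
      module)
    (by
      intros; ext1
      simp only [map_smul, LinearMap.smul_apply, LinearMap.coe_mk, AddHom.coe_mk]
      module)
    (by
      intros; ext1
      simp only [map_add, LinearMap.add_apply, LinearMap.coe_mk, AddHom.coe_mk]
      module)
    (by
      intros; ext1
      simp only [map_smul, LinearMap.smul_apply, LinearMap.coe_mk, AddHom.coe_mk]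
      module)

/-- The convolution bracket
`𝓛₃ (f₁, f₂, f₃) = m₃ ∘ ∑_σ ε(σ) sign(σ) f_{σ(1)} ⊗ f_{σ(2)} ⊗ f_{σ(3)} ∘ Δ²` on elements of degrees
`k₁`, `k₂`, `k₃`. The brackets `𝓛_p` with `p ≥ 4` vanish since `m_p = 0` for `p ≥ 4`. -/
def bracket₃ (W : TwoTermLeibniz K W₀ W₁) (k₁ k₂ k₃ : ℤ) :
    THom K V₀ V₁ W₀ W₁ →ₗ[K] THom K V₀ V₁ W₀ W₁ →ₗ[K] THom K V₀ V₁ W₀ W₁ →ₗ[K]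
      THom K V₀ V₁ W₀ W₁ :=
  (antisymm₃ k₁ k₂ k₃).compr₂ (LinearMap.llcomp K _ _ _ (LinearMap.llcomp K _ _ _ W.t₃))

/-- The element of degree `-1` of `L(V, W)` that corresponds to an infinity morphism: its components
are `f₁ s⁻¹` on words of length `1` and `f₂ (s ⊗ s)⁻¹` on words of length `2`. -/
def InfMorphism.toL {V : TwoTermLeibniz K V₀ V₁} {W : TwoTermLeibniz K W₀ W₁}
    (f : InfMorphism V W) : THom K V₀ V₁ W₀ W₁ :=
  LinearMap.prodMap f.f₁₀ f.f₁₁ ∘ₗ proj₁ +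
    LinearMap.inr K W₀ W₁ ∘ₗ TensorProduct.lift f.f₂ ∘ₗ
      TensorProduct.map (LinearMap.fst K V₀ V₁) (LinearMap.fst K V₀ V₁) ∘ₗ proj₂

end Convolution

/-! ### Polynomial differential forms on the 1-simplex -/

section Forms

variable (K : Type*) [Field K]

/-- The algebra `Ω₁ = K[t] ⊕ K[t] dt` of polynomial differential forms on the 1-simplex, with
`(dt)² = 0`; `t` is the barycentric coordinate that is `0` at the vertex `e₀` and `1` at the vertex
`e₁`. A form `a + b dt` has the components `fst = a` and `snd = b`. -/
abbrev Forms := DualNumber K[X]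

variable {K}

/-- The component of form degree `j`. -/
def formPr (j : Fin 2) : Forms K →ₗ[K] Forms K where
  toFun ω := if j = 0 then TrivSqZeroExt.inl ω.fst else TrivSqZeroExt.inr ω.snd
  map_add' := by intros; split_ifs <;> simp [add_smul]
  map_smul' := by intros; split_ifs <;> simp

/-- The de Rham differential `a + b dt ↦ a' dt`. -/
def formD : Forms K →ₗ[K] Forms K where
  toFun ω := TrivSqZeroExt.inr (Polynomial.derivative ω.fst)
  map_add' := by intros; simp [add_smul]
  map_smul' := by intros; simp

/-- The evaluation `ε₁ⁱ` of forms at the vertex `e_i`. -/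
def formEval (i : Fin 2) : Forms K →ₗ[K] K where
  toFun ω := ω.fst.eval (i.val : K)
  map_add' := by intros; simp
  map_smul' := by intros; simp

/-- The primitive of a polynomial that vanishes at `0`. -/
def primitive : K[X] →ₗ[K] K[X] :=
  Polynomial.lsum fun n => ((n + 1 : K)⁻¹) • Polynomial.monomial (n + 1)

/-- The homotopy operator `h₁ⁱ ω = ∫_I (φᵢ)^* ω`, with `φᵢ(u, t) = u t + (1 - u) e_i`: it sends
`a + b dt` to the primitive of `b` that vanishes at `e_i`. -/
def formH (i : Fin 2) : Forms K →ₗ[K] Forms K where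
  toFun ω := TrivSqZeroExt.inl
    (primitive ω.snd - Polynomial.C ((primitive ω.snd).eval (i.val : K)))
  map_add' := by
    intros
    simp only [TrivSqZeroExt.snd_add, map_add, Polynomial.eval_add, ← TrivSqZeroExt.inl_add]
    congr 1
    ring
  map_smul' := by
    intros
    simp only [TrivSqZeroExt.snd_smul, map_smul, Polynomial.eval_smul, RingHom.id_apply,
      ← TrivSqZeroExt.inl_smul, smul_sub, Polynomial.smul_C]

end Forms

/-! ### Maurer-Cartan elements of `L(V, W) ⊗ Ω₁` -/

section MaurerCartan

variable {K V₀ V₁ W₀ W₁ : Type*} [Field K]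
  [AddCommGroup V₀] [Module K V₀] [AddCommGroup V₁] [Module K V₁]
  [AddCommGroup W₀] [Module K W₀] [AddCommGroup W₁] [Module K W₁]

variable (K V₀ V₁ W₀ W₁) in
/-- The space that contains `L(V, W) ⊗ Ω₁`. -/
abbrev LForms := THom K V₀ V₁ W₀ W₁ ⊗[K] Forms K

variable (K V₀ V₁ W₀ W₁) in
/-- The component of degree `n` of `L ⊗ Ω₁`, i.e. `L_n ⊗ Ω₁⁰ ⊕ L_{n+1} ⊗ Ω₁¹`: forms are negatively
graded. -/
def totDeg (n : ℤ) : Submodule K (LForms K V₀ V₁ W₀ W₁) :=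
  ⨆ j : Fin 2, Submodule.map₂ (TensorProduct.mk K _ _) (convDeg K V₀ V₁ W₀ W₁ (n + j.val))
    (LinearMap.range (formPr (K := K) j))

/-- The component of form degree `j`. -/
def pr (j : Fin 2) : LForms K V₀ V₁ W₀ W₁ →ₗ[K] LForms K V₀ V₁ W₀ W₁ :=
  TensorProduct.map LinearMap.id (formPr j)

/-- The evaluation `L ⊗ Ω₁ → L` at the vertex `e_i`. -/
def evalAt (i : Fin 2) : LForms K V₀ V₁ W₀ W₁ →ₗ[K] THom K V₀ V₁ W₀ W₁ :=
  (TensorProduct.rid K _).toLinearMap ∘ₗ TensorProduct.map LinearMap.id (formEval i)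

/-- The homotopy operator `h₁ⁱ` on elements of degree `n` of `L ⊗ Ω₁`: as `h₁ⁱ` has degree `1`,
`h₁ⁱ(f ⊗ ω) = (-1)^|f| f ⊗ h₁ⁱ ω`, and `|f| = n + j` if `ω` has form degree `j`. -/
def homotopyOp (i : Fin 2) (n : ℤ) : LForms K V₀ V₁ W₀ W₁ →ₗ[K] LForms K V₀ V₁ W₀ W₁ :=
  ∑ j : Fin 2, ((-1 : K) ^ (n + j.val)) • TensorProduct.map LinearMap.id (formH i) ∘ₗ pr j

/-- The differential of `L ⊗ Ω₁` on elements of degree `n`: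
`f ⊗ ω ↦ 𝓛₁ f ⊗ ω + (-1)^|f| f ⊗ dω`, where `|f| = n + j` if `ω` has form degree `j`. -/
def extBracket₁ (V : TwoTermLeibniz K V₀ V₁) (W : TwoTermLeibniz K W₀ W₁) (n : ℤ)
    (F : LForms K V₀ V₁ W₀ W₁) : LForms K V₀ V₁ W₀ W₁ :=
  ∑ j : Fin 2, (TensorProduct.map (bracket₁ V W (n + j.val)) LinearMap.id (pr j F)
    + ((-1 : K) ^ (n + j.val)) • TensorProduct.map LinearMap.id formD (pr j F))

/-- The bracket `(f₁ ⊗ ω₁, f₂ ⊗ ω₂) ↦ (-1)^(|ω₁||f₂|) 𝓛₂(f₁, f₂) ⊗ ω₁ω₂` of `L ⊗ Ω₁` on elements of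
degrees `n₁`, `n₂`. -/
def extBracket₂ (W : TwoTermLeibniz K W₀ W₁) (n₁ n₂ : ℤ)
    (F₁ F₂ : LForms K V₀ V₁ W₀ W₁) : LForms K V₀ V₁ W₀ W₁ :=
  ∑ j₁ : Fin 2, ∑ j₂ : Fin 2, ((-1 : K) ^ ((j₁.val : ℤ) * (n₂ + j₂.val))) •
    TensorProduct.map₂ (bracket₂ W (n₁ + j₁.val) (n₂ + j₂.val)) (LinearMap.mul K (Forms K))
      (pr j₁ F₁) (pr j₂ F₂)

/-- The bracket
`(f₁ ⊗ ω₁, f₂ ⊗ ω₂, f₃ ⊗ ω₃) ↦ (-1)^(|ω₁|(|f₂| + |f₃|) + |ω₂||f₃|) 𝓛₃(f₁, f₂, f₃) ⊗ ω₁ω₂ω₃` of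
`L ⊗ Ω₁` on elements of degrees `n₁`, `n₂`, `n₃`. -/
def extBracket₃ (W : TwoTermLeibniz K W₀ W₁) (n₁ n₂ n₃ : ℤ)
    (F₁ F₂ F₃ : LForms K V₀ V₁ W₀ W₁) : LForms K V₀ V₁ W₀ W₁ :=
  ∑ j₁ : Fin 2, ∑ j₂ : Fin 2, ∑ j₃ : Fin 2,
    ((-1 : K) ^ ((j₁.val : ℤ) * ((n₂ + j₂.val) + (n₃ + j₃.val)) + j₂.val * (n₃ + j₃.val))) •
    TensorProduct.homTensorHomMap (RingHom.id K) _ _ _ _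
      (TensorProduct.map₂ (bracket₃ W (n₁ + j₁.val) (n₂ + j₂.val) (n₃ + j₃.val))
        ((LinearMap.mul K (Forms K)).compr₂ (LinearMap.mul K (Forms K)))
        (pr j₁ F₁) (pr j₂ F₂))
      (pr j₃ F₃)

/-- The left hand side `∑_p (1/p!) (-1)^(p(p-1)/2) 𝓛_p(α, …, α)` of the Maurer-Cartan equation for an
element `α` of degree `-1` of `L ⊗ Ω₁`. -/
def curvature (V : TwoTermLeibniz K V₀ V₁) (W : TwoTermLeibniz K W₀ W₁)
    (α : LForms K V₀ V₁ W₀ W₁) : LForms K V₀ V₁ W₀ W₁ :=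
  extBracket₁ V W (-1) α - (1 / 2 : K) • extBracket₂ W (-1) (-1) α α
    - (1 / 6 : K) • extBracket₃ W (-1) (-1) (-1) α α α

/-- Infinity homotopies between infinity morphisms from `V` to `W`: the Maurer-Cartan elements of
`L(V, W) ⊗ Ω₁`. -/
structure InfHomotopy (V : TwoTermLeibniz K V₀ V₁) (W : TwoTermLeibniz K W₀ W₁) where
  α : LForms K V₀ V₁ W₀ W₁
  degree : α ∈ totDeg K V₀ V₁ W₀ W₁ (-1)
  maurerCartan : curvature V W α = 0

/-- The infinity homotopies from `f` to `g`. -/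
def infHomotopies {V : TwoTermLeibniz K V₀ V₁} {W : TwoTermLeibniz K W₀ W₁}
    (f g : InfMorphism V W) : Set (InfHomotopy V W) :=
  {a | evalAt 0 a.α = f.toL ∧ evalAt 1 a.α = g.toL}

/-- The 2-term infinity homotopies from `f` to `g`. -/
def twoTermHomotopies {V : TwoTermLeibniz K V₀ V₁} {W : TwoTermLeibniz K W₀ W₁}
    (f g : InfMorphism V W) : Set (TwoTermHomotopy V W) :=
  {a | a.f = f ∧ a.g = g}

/-- The homotopy parameter `(β(1) - β(0)) s : V₀ → W₁` of an element `α` of degree `-1` of `L ⊗ Ω₁`,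
where `β = h₁ⁱ α`. -/
def homotopyParam (i : Fin 2) (α : LForms K V₀ V₁ W₀ W₁) : V₀ →ₗ[K] W₁ :=
  LinearMap.snd K W₀ W₁ ∘ₗ
    (evalAt 1 (homotopyOp i (-1) α) - evalAt 0 (homotopyOp i (-1) α)) ∘ₗ
    TensorAlgebra.ι K ∘ₗ LinearMap.inl K V₀ V₁

end MaurerCartan

end

end LeibInf

/-! By degree, an element of degree `-1` of `L ⊗ Ω₁` is a polynomial path `F(t) + B(t) dt`,
where `F(t)` consists of maps `V₀ → W₀`, `V₁ → W₁` and `V₀ ⊗ V₀ → W₁` and `B(t)` is a single map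
`V₀ → W₁`. The Maurer-Cartan equation says that every `F(t)` is a Maurer-Cartan element of `L`, that
is, an infinity morphism, and that `F' = d_F B`, where `d_F` is the differential twisted by `F`.

Let `θ(t) = ∫₀ᵗ B`. The components `F₁₀`, `F₁₁` of `F` have derivatives `m₁ B`, `B l₁`, so that
`F₁₀(t) = F₁₀(0) + m₁ θ(t)`. The derivative of the third component contains the quadratic
expressions `m₂(F₁₀ x, B y)` and `m₂(B x, F₁₀ y)`; their sum can be integrated because
`m₂(m₁ θ x, B y) + m₂(B x, m₁ θ y)` is the derivative of `m₂(θ x, m₁ θ y)`. Hence `θ(1)` is a 2-term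
homotopy from `F(0)` to `F(1)`. Conversely, a 2-term homotopy from `f` with parameter `θ` comes from
the path `t ↦ f^{tθ} + θ dt`, where `f^{tθ}` is the target of the homotopy with parameter `tθ`.

Degrees are tested by an action of `Kˣ`: `c` acts on the part of degree `n` as `cⁿ`, and `K` is
infinite.
-/

namespace LeibInf

noncomputable section

open TensorAlgebra (ι)

/-! ### Words -/

section WordDeg

variable {V₀ V₁ : Type*}

theorem wordDeg_nil : wordDeg ([] : List (V₀ ⊕ V₁)) = 0 := rfl

theorem wordDeg_cons (a : V₀ ⊕ V₁) (l : List (V₀ ⊕ V₁)) :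
    wordDeg (a :: l) = letterDeg a + wordDeg l :=
  List.sum_cons

end WordDeg

section Words

variable {K M X : Type*} [Field K] [AddCommGroup M] [Module K M] [AddCommGroup X] [Module K X]

theorem tensorAlgebra_cons_induction {p : TensorAlgebra K M → Prop} (one : p 1)
    (cons : ∀ v w, p w → p (ι K v * w)) (add : ∀ a b, p a → p b → p (a + b))
    (smul : ∀ (c : K) a, p a → p (c • a)) (w : TensorAlgebra K M) : p w := by
  suffices h : ∀ b, p b → p (w * b) by simpa using h 1 one
  induction w using TensorAlgebra.induction with
  | algebraMap r => intro b hb; rw [← Algebra.smul_def]; exact smul r b hb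
  | ι v => exact fun b hb => cons v b hb
  | mul a b ha hb => intro c hc; rw [mul_assoc]; exact ha _ (hb _ hc)
  | add a b ha hb => intro c hc; rw [add_mul]; exact add _ _ (ha c hc) (hb c hc)

theorem tensorAlgebra_linearMap_ext {F G : TensorAlgebra K M →ₗ[K] X} (one : F 1 = G 1)
    (cons : ∀ v w, F w = G w → F (ι K v * w) = G (ι K v * w)) : F = G := by
  ext1 w
  induction w using tensorAlgebra_cons_induction with
  | one => exact one
  | cons v w h => exact cons v w h
  | add a b ha hb => rw [map_add, map_add, ha, hb]
  | smul c a ha => rw [map_smul, map_smul, ha]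

end Words

section Zinbiel

variable {K V₀ V₁ X : Type*} [Field K] [AddCommGroup V₀] [Module K V₀] [AddCommGroup V₁]
  [Module K V₁] [AddCommGroup X] [Module K X]

theorem word_nil : (word [] : Tens K V₀ V₁) = 1 := rfl

theorem word_cons (a : V₀ ⊕ V₁) (l : List (V₀ ⊕ V₁)) :
    (word (a :: l) : Tens K V₀ V₁) = letter a * word l :=
  List.prod_cons

theorem ι_mul_word (v : V₀ × V₁) (l : List (V₀ ⊕ V₁)) :
    (ι K v * word l : Tens K V₀ V₁) = word (.inl v.1 :: l) + word (.inr v.2 :: l) := by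
  rw [word_cons, word_cons, letter, letter, ← add_mul, ← map_add, Prod.mk_add_mk, add_zero,
    zero_add]

variable (K V₀ V₁) in
theorem span_range_word : Submodule.span K (Set.range (word : _ → Tens K V₀ V₁)) = ⊤ := by
  refine Submodule.eq_top_iff'.2 fun w => ?_
  induction w using tensorAlgebra_cons_induction with
  | one => exact Submodule.subset_span ⟨[], word_nil⟩
  | add a b ha hb => exact Submodule.add_mem _ ha hb
  | smul c a ha => exact Submodule.smul_mem _ c ha
  | cons v w hw =>
    induction hw using Submodule.span_induction with
    | mem w hw =>
      obtain ⟨l, rfl⟩ := hw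
      rw [ι_mul_word]
      exact Submodule.add_mem _ (Submodule.subset_span ⟨_, rfl⟩) (Submodule.subset_span ⟨_, rfl⟩)
    | zero => rw [mul_zero]; exact Submodule.zero_mem _
    | add a b _ _ ha hb => rw [mul_add]; exact Submodule.add_mem _ ha hb
    | smul c a _ ha => rw [mul_smul_comm]; exact Submodule.smul_mem _ c ha

theorem tens_linearMap_ext_word {F G : Tens K V₀ V₁ →ₗ[K] X}
    (h : ∀ l, F (word l) = G (word l)) : F = G :=
  LinearMap.ext_on_range (span_range_word K V₀ V₁) h

theorem red_one : red (1 : Tens K V₀ V₁) = 0 := by simp [red]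

theorem red_ι_mul (v : V₀ × V₁) (w : Tens K V₀ V₁) : red (ι K v * w) = ι K v * w := by
  simp [red, TensorAlgebra.algebraMapInv]

theorem koszul_ι (k : ℤ) (v : V₀ × V₁) :
    koszul k (ι K v) = ι K ((-1 : K) ^ k • v.1, v.2) := by
  simp [koszul]

theorem coprod_one : coprod (1 : Tens K V₀ V₁) = 0 := tRec_one _ _

theorem coprod_ι_mul (v : V₀ × V₁) (w : Tens K V₀ V₁) :
    coprod (ι K v * w) = ι K v ⊗ₜ[K] red w
      + TensorProduct.map (LinearMap.mul K (Tens K V₀ V₁) (ι K v)) LinearMap.id (coprod w)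
      + TensorProduct.map (koszul 1).toLinearMap
          (LinearMap.mul K (Tens K V₀ V₁) (ι K (v.1, (0 : V₁)))) (coprod w)
      + TensorProduct.map LinearMap.id
          (LinearMap.mul K (Tens K V₀ V₁) (ι K ((0 : V₀), v.2))) (coprod w) := by
  rw [coprod, tRec_ι_mul, LinearMap.mk₂_apply]
  rfl

theorem deconc_one : deconc (1 : Tens K V₀ V₁) = 1 ⊗ₜ[K] 1 := tRec_one _ _

theorem deconc_ι_mul (v : V₀ × V₁) (w : Tens K V₀ V₁) :
    deconc (ι K v * w) = 1 ⊗ₜ[K] (ι K v * w)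
      + TensorProduct.map (LinearMap.mul K (Tens K V₀ V₁) (ι K v)) LinearMap.id (deconc w) :=
  tRec_ι_mul _ _ _ _

theorem proj₁_one : proj₁ (1 : Tens K V₀ V₁) = 0 := tRec_one _ _

theorem proj₁_ι_mul (v : V₀ × V₁) (w : Tens K V₀ V₁) :
    proj₁ (ι K v * w) = TensorAlgebra.algebraMapInv w • v :=
  tRec_ι_mul _ _ _ _

theorem proj₂_one : proj₂ (1 : Tens K V₀ V₁) = 0 := tRec_one _ _

theorem proj₂_ι_mul (v : V₀ × V₁) (w : Tens K V₀ V₁) :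
    proj₂ (ι K v * w) = v ⊗ₜ[K] proj₁ w :=
  tRec_ι_mul _ _ _ _

theorem proj₃_one : proj₃ (1 : Tens K V₀ V₁) = 0 := tRec_one _ _

theorem proj₃_ι_mul (v : V₀ × V₁) (w : Tens K V₀ V₁) :
    proj₃ (ι K v * w) = v ⊗ₜ[K] proj₂ w :=
  tRec_ι_mul _ _ _ _

/-! ### The grading as an action of the multiplicative group -/

/-- The operator `v ↦ c^|v| v` on `V = V₀ ⊕ V₁`. Over an infinite field, a linear map is
homogeneous of degree `k` if and only if it intertwines these operators up to the factors `c^k`. -/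
def scaleVec (c : K) : V₀ × V₁ →ₗ[K] V₀ × V₁ := LinearMap.prodMap LinearMap.id (c • LinearMap.id)

/-- The operator `w ↦ c^|w| w` on `T(sV)`; the degree of a letter is raised by `1` by the
suspension. -/
def scaleWord (c : K) : Tens K V₀ V₁ →ₐ[K] Tens K V₀ V₁ :=
  TensorAlgebra.lift K (ι K ∘ₗ (c • scaleVec c))

theorem scaleVec_apply (c : K) (v : V₀ × V₁) : scaleVec c v = (v.1, c • v.2) := rfl

theorem scaleWord_ι (c : K) (v : V₀ × V₁) : scaleWord c (ι K v) = c • ι K (scaleVec c v) := by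
  simp [scaleWord]

theorem scaleWord_letter (c : Kˣ) (a : V₀ ⊕ V₁) :
    scaleWord (c : K) (letter a) = (c : K) ^ letterDeg a • (letter a : Tens K V₀ V₁) := by
  cases a with
  | inl x => simp [letter, letterDeg, scaleWord_ι, scaleVec_apply]
  | inr h =>
    simp only [letter, letterDeg, scaleWord_ι, scaleVec_apply, zpow_two, mul_smul, ← map_smul,
      Prod.smul_mk, smul_zero]

theorem scaleWord_word (c : Kˣ) (l : List (V₀ ⊕ V₁)) :
    scaleWord (c : K) (word l) = (c : K) ^ wordDeg l • (word l : Tens K V₀ V₁) := by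
  induction l with
  | nil => rw [word_nil, map_one, wordDeg_nil, zpow_zero, one_smul]
  | cons a l ih =>
    rw [word_cons, map_mul, scaleWord_letter, ih, wordDeg_cons, zpow_add₀ c.ne_zero,
      smul_mul_smul_comm]

theorem exists_units_zpow_ne_one [Infinite K] {n : ℤ} (hn : n ≠ 0) : ∃ c : Kˣ, (c : K) ^ n ≠ 1 := by
  open Polynomial in
  have hp : (X * (X ^ n.natAbs - 1) : K[X]) ≠ 0 :=
    mul_ne_zero X_ne_zero (X_pow_sub_C_ne_zero (Int.natAbs_pos.2 hn) 1)
  obtain ⟨c, hc⟩ : ∃ c : K, (Polynomial.X * (Polynomial.X ^ n.natAbs - 1) : K[X]).eval c ≠ 0 := by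
    by_contra! h
    exact hp (Polynomial.funext fun c => by rw [h, Polynomial.eval_zero])
  simp only [Polynomial.eval_mul, Polynomial.eval_X, Polynomial.eval_sub, Polynomial.eval_pow,
    Polynomial.eval_one, mul_ne_zero_iff, sub_ne_zero] at hc
  refine ⟨Units.mk0 c hc.1, fun h => hc.2 ?_⟩
  rw [Units.val_mk0] at h
  rcases n.natAbs_eq with e | e <;> rw [e] at h <;>
    simpa only [zpow_neg, zpow_natCast, inv_eq_one] using h

theorem forall_zpow_smul_eq_self_iff [Infinite K] {n : ℤ} {x : X} :
    (∀ c : Kˣ, (c : K) ^ n • x = x) ↔ (n ≠ 0 → x = 0) := by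
  refine ⟨fun h hn => ?_, fun h c => ?_⟩
  · obtain ⟨c, hc⟩ := exists_units_zpow_ne_one (K := K) hn
    have hx : ((c : K) ^ n - 1) • x = 0 := by rw [sub_smul, h c, one_smul, sub_self]
    exact (smul_eq_zero.1 hx).resolve_left (sub_ne_zero.2 hc)
  · by_cases hn : n = 0
    · rw [hn, zpow_zero, one_smul]
    · rw [h hn, smul_zero]

theorem mem_gr_iff [Infinite K] {n : ℤ} {v : V₀ × V₁} :
    v ∈ gr K V₀ V₁ n ↔ ∀ c : Kˣ, scaleVec (c : K) v = (c : K) ^ n • v := by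
  change ((n ≠ 0 → v.1 = 0) ∧ (n ≠ 1 → v.2 = 0)) ↔ _
  simp only [Prod.ext_iff, scaleVec_apply, Prod.smul_fst, Prod.smul_snd, forall_and]
  refine and_congr ?_ ?_
  · rw [← forall_zpow_smul_eq_self_iff (K := K)]
    exact forall_congr' fun c => eq_comm
  · rw [← sub_ne_zero, ← forall_zpow_smul_eq_self_iff (K := K)]
    refine forall_congr' fun c => ?_
    rw [zpow_sub_one₀ c.ne_zero, mul_comm, mul_smul, inv_smul_eq_iff₀ c.ne_zero, eq_comm]

/-! ### Equivariance of the structure maps -/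

theorem mul_comp_scaleWord (c : K) (a : Tens K V₀ V₁) :
    LinearMap.mul K _ (scaleWord c a) ∘ₗ (scaleWord c).toLinearMap
      = (scaleWord c).toLinearMap ∘ₗ LinearMap.mul K _ a :=
  LinearMap.ext fun b => (map_mul (scaleWord c) a b).symm

theorem red_scaleWord (c : K) (w : Tens K V₀ V₁) : red (scaleWord c w) = scaleWord c (red w) := by
  suffices h : red ∘ₗ (scaleWord c).toLinearMap = (scaleWord c).toLinearMap ∘ₗ red from
    LinearMap.congr_fun h w
  refine tensorAlgebra_linearMap_ext ?_ fun v w _ => ?_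
  · simp [red_one]
  · simp [red_ι_mul, scaleWord_ι]

theorem koszul_comp_scaleWord (k : ℤ) (c : K) :
    (koszul k).comp (scaleWord c)
      = (scaleWord c).comp (koszul k : Tens K V₀ V₁ →ₐ[K] Tens K V₀ V₁) := by
  ext x <;> simp [scaleWord_ι, koszul_ι, scaleVec_apply]

theorem koszul_scaleWord (k : ℤ) (c : K) (w : Tens K V₀ V₁) :
    koszul k (scaleWord c w) = scaleWord c (koszul k w) :=
  AlgHom.congr_fun (koszul_comp_scaleWord k c) w

theorem coprod_scaleWord (c : K) (w : Tens K V₀ V₁) : coprod (scaleWord c w)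
    = TensorProduct.map (scaleWord c).toLinearMap (scaleWord c).toLinearMap (coprod w) := by
  suffices h : coprod ∘ₗ (scaleWord c).toLinearMap
      = TensorProduct.map (scaleWord c).toLinearMap (scaleWord c).toLinearMap ∘ₗ coprod from
    LinearMap.congr_fun h w
  refine tensorAlgebra_linearMap_ext ?_ fun v w h => ?_
  · simp [coprod_one]
  · have hk : (koszul 1).toLinearMap ∘ₗ (scaleWord c).toLinearMap = (scaleWord c).toLinearMap ∘ₗ
        (koszul 1 : Tens K V₀ V₁ →ₐ[K] Tens K V₀ V₁).toLinearMap :=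
      congrArg AlgHom.toLinearMap (koszul_comp_scaleWord 1 c)
    have hinl : ((scaleVec c v).1, (0 : V₁)) = scaleVec c (v.1, (0 : V₁)) := by
      simp [scaleVec_apply]
    have hinr : ((0 : V₀), (scaleVec c v).2) = scaleVec c ((0 : V₀), v.2) := by
      simp [scaleVec_apply]
    simp only [LinearMap.comp_apply, AlgHom.toLinearMap_apply] at h ⊢
    simp only [map_mul, scaleWord_ι, smul_mul_assoc, map_smul, coprod_ι_mul, h, red_scaleWord,
      map_add, TensorProduct.map_tmul, AlgHom.toLinearMap_apply, TensorProduct.map_map,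
      LinearMap.id_comp, LinearMap.comp_id, ← mul_comp_scaleWord, hk, smul_add, hinl, hinr,
      TensorProduct.map_smul_left, TensorProduct.map_smul_right, LinearMap.smul_comp,
      LinearMap.smul_apply, TensorProduct.smul_tmul']

theorem coprodPlus_scaleWord (c : K) (w : Tens K V₀ V₁) : coprodPlus (scaleWord c w)
    = TensorProduct.map (scaleWord c).toLinearMap (scaleWord c).toLinearMap (coprodPlus w) := by
  simp [coprodPlus, coprod_scaleWord, red_scaleWord]

theorem deconc_scaleWord (c : K) (w : Tens K V₀ V₁) : deconc (scaleWord c w)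
    = TensorProduct.map (scaleWord c).toLinearMap (scaleWord c).toLinearMap (deconc w) := by
  suffices h : deconc ∘ₗ (scaleWord c).toLinearMap
      = TensorProduct.map (scaleWord c).toLinearMap (scaleWord c).toLinearMap ∘ₗ deconc from
    LinearMap.congr_fun h w
  refine tensorAlgebra_linearMap_ext ?_ fun v w h => ?_
  · simp [deconc_one]
  · simp only [LinearMap.comp_apply, AlgHom.toLinearMap_apply] at h ⊢
    simp only [map_mul, scaleWord_ι, smul_mul_assoc, map_smul, deconc_ι_mul, h, map_add,
      TensorProduct.map_tmul, AlgHom.toLinearMap_apply, map_one, TensorProduct.map_map,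
      LinearMap.id_comp, LinearMap.comp_id, ← mul_comp_scaleWord, TensorProduct.map_smul_left,
      LinearMap.smul_comp, LinearMap.smul_apply, smul_add, TensorProduct.tmul_smul]

theorem algebraMapInv_scaleWord (c : K) (w : Tens K V₀ V₁) :
    TensorAlgebra.algebraMapInv (scaleWord c w) = TensorAlgebra.algebraMapInv w := by
  suffices h : TensorAlgebra.algebraMapInv.comp (scaleWord c)
      = TensorAlgebra.algebraMapInv (R := K) (M := V₀ × V₁) from AlgHom.congr_fun h w
  ext x <;> simp [scaleWord_ι, TensorAlgebra.algebraMapInv]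

theorem proj₁_scaleWord (c : K) (w : Tens K V₀ V₁) :
    proj₁ (scaleWord c w) = c • scaleVec c (proj₁ w) := by
  suffices h : proj₁ ∘ₗ (scaleWord c).toLinearMap
      = c • (scaleVec c ∘ₗ proj₁ : Tens K V₀ V₁ →ₗ[K] _) from LinearMap.congr_fun h w
  refine tensorAlgebra_linearMap_ext ?_ fun v w _ => ?_
  · simp [proj₁_one]
  · simp [scaleWord_ι, proj₁_ι_mul, algebraMapInv_scaleWord]

theorem proj₂_scaleWord (c : K) (w : Tens K V₀ V₁) : proj₂ (scaleWord c w)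
    = c ^ 2 • TensorProduct.map (scaleVec c) (scaleVec c) (proj₂ w) := by
  suffices h : proj₂ ∘ₗ (scaleWord c).toLinearMap
      = c ^ 2 • (TensorProduct.map (scaleVec c) (scaleVec c) ∘ₗ proj₂ : Tens K V₀ V₁ →ₗ[K] _) from
    LinearMap.congr_fun h w
  refine tensorAlgebra_linearMap_ext ?_ fun v w _ => ?_
  · simp [proj₂_one]
  · simp [scaleWord_ι, proj₂_ι_mul, proj₁_scaleWord, smul_smul, pow_two]

theorem proj₃_scaleWord (c : K) (w : Tens K V₀ V₁) : proj₃ (scaleWord c w)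
    = c ^ 3 • TensorProduct.map (scaleVec c) (TensorProduct.map (scaleVec c) (scaleVec c))
        (proj₃ w) := by
  suffices h : proj₃ ∘ₗ (scaleWord c).toLinearMap = c ^ 3 • (TensorProduct.map (scaleVec c)
      (TensorProduct.map (scaleVec c) (scaleVec c)) ∘ₗ proj₃ : Tens K V₀ V₁ →ₗ[K] _) from
    LinearMap.congr_fun h w
  refine tensorAlgebra_linearMap_ext ?_ fun v w _ => ?_
  · simp [proj₃_one]
  · simp [scaleWord_ι, proj₃_ι_mul, proj₂_scaleWord, smul_smul, pow_succ']

namespace TwoTermLeibniz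

variable (V : TwoTermLeibniz K V₀ V₁)

theorem t₁_apply (u : V₀ × V₁) : V.t₁ u = (V.l₁ u.2, 0) := rfl

theorem t₂_tmul (u v : V₀ × V₁) :
    V.t₂ (u ⊗ₜ v) = (V.l₂ u.1 v.1, V.l₂r u.1 v.2 + V.l₂l u.2 v.1) := by
  simp [t₂]

theorem t₃_tmul (u v w : V₀ × V₁) : V.t₃ (u ⊗ₜ (v ⊗ₜ w)) = (0, V.l₃ u.1 v.1 w.1) := by
  simp [t₃]

theorem t₁_scaleVec (c : K) (u : V₀ × V₁) :
    V.t₁ (scaleVec c u) = c • scaleVec c (V.t₁ u) := by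
  simp [t₁_apply, scaleVec_apply]

theorem t₂_map_scaleVec (c : K) (z : (V₀ × V₁) ⊗[K] (V₀ × V₁)) :
    V.t₂ (TensorProduct.map (scaleVec c) (scaleVec c) z) = scaleVec c (V.t₂ z) := by
  suffices h : V.t₂ ∘ₗ TensorProduct.map (scaleVec c) (scaleVec c) = scaleVec c ∘ₗ V.t₂ from
    LinearMap.congr_fun h z
  refine TensorProduct.ext' fun u v => ?_
  simp [t₂_tmul, scaleVec_apply]

theorem smul_t₃_map_scaleVec (c : K) (z : (V₀ × V₁) ⊗[K] ((V₀ × V₁) ⊗[K] (V₀ × V₁))) :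
    c • V.t₃ (TensorProduct.map (scaleVec c) (TensorProduct.map (scaleVec c) (scaleVec c)) z)
      = scaleVec c (V.t₃ z) := by
  suffices h : c • V.t₃ ∘ₗ TensorProduct.map (scaleVec c)
      (TensorProduct.map (scaleVec c) (scaleVec c)) = scaleVec c ∘ₗ V.t₃ from
    LinearMap.congr_fun h z
  refine TensorProduct.ext_threefold' fun u v w => ?_
  simp [t₃_tmul, scaleVec_apply]

theorem corestr_scaleWord (c : K) (w : Tens K V₀ V₁) :
    V.corestr (scaleWord c w) = c ^ 2 • scaleVec c (V.corestr w) := by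
  have hp (z : (V₀ × V₁) ⊗[K] (V₀ × V₁)) :
      TensorProduct.map parity LinearMap.id (TensorProduct.map (scaleVec c) (scaleVec c) z)
        = TensorProduct.map (scaleVec c) (scaleVec c)
          (TensorProduct.map parity LinearMap.id z) := by
    rw [TensorProduct.map_map, TensorProduct.map_map]
    congr 2
    ext <;> simp [parity, scaleVec_apply]
  simp only [corestr, LinearMap.add_apply, LinearMap.comp_apply, proj₁_scaleWord, proj₂_scaleWord,
    proj₃_scaleWord, map_smul, map_add, smul_add, t₁_scaleVec, ← t₂_map_scaleVec,
    ← smul_t₃_map_scaleVec, smul_smul, hp, ← pow_two, ← pow_succ]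

/-- The part of the codifferential in which a bracket has absorbed the last letter:
`codiff` applies it to the initial segments of a word. -/
def codiffInit : Tens K V₀ V₁ →ₗ[K] Tens K V₀ V₁ :=
  LinearMap.mul' K _ ∘ₗ
    TensorProduct.map (koszul (-1)).toLinearMap (ι K ∘ₗ V.corestr) ∘ₗ coprodPlus

theorem codiff_eq :
    V.codiff = LinearMap.mul' K _ ∘ₗ TensorProduct.map V.codiffInit LinearMap.id ∘ₗ deconc :=
  rfl

theorem codiffInit_scaleWord (c : K) (w : Tens K V₀ V₁) :
    V.codiffInit (scaleWord c w) = c • scaleWord c (V.codiffInit w) := by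
  rw [codiffInit, LinearMap.comp_apply, LinearMap.comp_apply, coprodPlus_scaleWord,
    LinearMap.comp_apply, LinearMap.comp_apply]
  generalize coprodPlus w = z
  induction z using TensorProduct.induction_on with
  | zero => simp only [map_zero, smul_zero]
  | tmul a b =>
    simp only [TensorProduct.map_tmul, AlgHom.toLinearMap_apply, LinearMap.comp_apply,
      LinearMap.mul'_apply, corestr_scaleWord, koszul_scaleWord, map_smul, mul_smul_comm, map_mul,
      scaleWord_ι, pow_two, smul_smul]
  | add x y hx hy => simp only [map_add, hx, hy, smul_add]

theorem codiff_scaleWord (c : K) (w : Tens K V₀ V₁) :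
    V.codiff (scaleWord c w) = c • scaleWord c (V.codiff w) := by
  rw [codiff_eq, LinearMap.comp_apply, LinearMap.comp_apply, deconc_scaleWord,
    LinearMap.comp_apply, LinearMap.comp_apply]
  generalize deconc w = z
  induction z using TensorProduct.induction_on with
  | zero => simp only [map_zero, smul_zero]
  | tmul a b =>
    simp only [TensorProduct.map_tmul, AlgHom.toLinearMap_apply, LinearMap.id_apply,
      LinearMap.mul'_apply, codiffInit_scaleWord, smul_mul_assoc, map_mul]
  | add x y hx hy => simp only [map_add, hx, hy, smul_add]

end TwoTermLeibniz

end Zinbiel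

/-! ### Homogeneity of the convolution brackets -/

section Convolution

variable {K V₀ V₁ W₀ W₁ : Type*} [Field K]
  [AddCommGroup V₀] [Module K V₀] [AddCommGroup V₁] [Module K V₁]
  [AddCommGroup W₀] [Module K W₀] [AddCommGroup W₁] [Module K W₁]

theorem conv₂_apply (k₂ : ℤ) (f₁ f₂ : THom K V₀ V₁ W₀ W₁) (w : Tens K V₀ V₁) :
    conv₂ k₂ f₁ f₂ w = TensorProduct.map (f₁ ∘ₗ (koszul k₂).toLinearMap) f₂ (coprod w) :=
  rfl

theorem conv₃_apply (k₂ k₃ : ℤ) (f₁ f₂ f₃ : THom K V₀ V₁ W₀ W₁) (w : Tens K V₀ V₁) :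
    conv₃ k₂ k₃ f₁ f₂ f₃ w = TensorProduct.assoc K _ _ _
      (TensorProduct.map (conv₂ k₂ f₁ f₂ ∘ₗ (koszul k₃).toLinearMap) f₃ (coprod w)) :=
  rfl

theorem bracket₁_apply (V : TwoTermLeibniz K V₀ V₁) (W : TwoTermLeibniz K W₀ W₁) (k : ℤ)
    (f : THom K V₀ V₁ W₀ W₁) (w : Tens K V₀ V₁) :
    bracket₁ V W k f w = W.t₁ (f w) + (-1 : K) ^ k • f (V.codiff w) :=
  rfl

theorem bracket₂_apply (W : TwoTermLeibniz K W₀ W₁) (k₁ k₂ : ℤ) (f₁ f₂ : THom K V₀ V₁ W₀ W₁)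
    (w : Tens K V₀ V₁) : bracket₂ W k₁ k₂ f₁ f₂ w
      = W.t₂ (conv₂ k₂ f₁ f₂ w) - (-1 : K) ^ (k₁ * k₂) • W.t₂ (conv₂ k₁ f₂ f₁ w) := by
  simp [bracket₂, antisymm₂]

theorem bracket₃_apply (W : TwoTermLeibniz K W₀ W₁) (k₁ k₂ k₃ : ℤ)
    (f₁ f₂ f₃ : THom K V₀ V₁ W₀ W₁) (w : Tens K V₀ V₁) : bracket₃ W k₁ k₂ k₃ f₁ f₂ f₃ w
      = W.t₃ (conv₃ k₂ k₃ f₁ f₂ f₃ w)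
          - (-1 : K) ^ (k₁ * k₂) • W.t₃ (conv₃ k₁ k₃ f₂ f₁ f₃ w)
          - (-1 : K) ^ (k₂ * k₃) • W.t₃ (conv₃ k₃ k₂ f₁ f₃ f₂ w)
          + (-1 : K) ^ (k₁ * k₂ + k₁ * k₃) • W.t₃ (conv₃ k₃ k₁ f₂ f₃ f₁ w)
          + (-1 : K) ^ (k₁ * k₃ + k₂ * k₃) • W.t₃ (conv₃ k₁ k₂ f₃ f₁ f₂ w)
          - (-1 : K) ^ (k₁ * k₂ + k₁ * k₃ + k₂ * k₃) • W.t₃ (conv₃ k₂ k₁ f₃ f₂ f₁ w) := by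
  simp [bracket₃, antisymm₃]

theorem TwoTermLeibniz.codiff_one (V : TwoTermLeibniz K V₀ V₁) : V.codiff 1 = 0 := by
  simp [codiff_eq, codiffInit, deconc_one, coprodPlus, coprod_one, red_one]

variable [Infinite K]

theorem mem_convDeg_iff {k : ℤ} {f : THom K V₀ V₁ W₀ W₁} :
    f ∈ convDeg K V₀ V₁ W₀ W₁ k ↔
      f 1 = 0 ∧ ∀ (c : Kˣ) w, scaleVec (c : K) (f w) = (c : K) ^ k • f (scaleWord (c : K) w) := by
  change (f 1 = 0 ∧ ∀ l : List (V₀ ⊕ V₁), f (word l) ∈ gr K W₀ W₁ (wordDeg l + k)) ↔ _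
  simp only [mem_gr_iff]
  have hword (c : Kˣ) (l : List (V₀ ⊕ V₁)) :
      (c : K) ^ k • f (scaleWord (c : K) (word l)) = (c : K) ^ (wordDeg l + k) • f (word l) := by
    rw [scaleWord_word, map_smul, smul_smul, add_comm, zpow_add₀ c.ne_zero]
  refine and_congr_right fun _ => ⟨fun h c => ?_, fun h l c => (h c _).trans (hword c l)⟩
  refine LinearMap.congr_fun (f := scaleVec (c : K) ∘ₗ f)
    (g := (c : K) ^ k • f ∘ₗ (scaleWord (c : K)).toLinearMap) ?_
  exact tens_linearMap_ext_word fun l => (h l c).trans (hword c l).symm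

theorem bracket₁_mem (V : TwoTermLeibniz K V₀ V₁) (W : TwoTermLeibniz K W₀ W₁) {k : ℤ}
    {f : THom K V₀ V₁ W₀ W₁} (hf : f ∈ convDeg K V₀ V₁ W₀ W₁ k) :
    bracket₁ V W k f ∈ convDeg K V₀ V₁ W₀ W₁ (k - 1) := by
  rw [mem_convDeg_iff] at hf ⊢
  refine ⟨by rw [bracket₁_apply, hf.1, V.codiff_one, map_zero, map_zero, smul_zero, add_zero],
    fun c w => smul_right_injective _ c.ne_zero ?_⟩
  simp only [bracket₁_apply, map_add, map_smul, smul_add, ← W.t₁_scaleVec, hf.2,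
    V.codiff_scaleWord, smul_smul, zpow_sub_one₀ c.ne_zero]
  congr 2 <;> field_simp

theorem map_scaleVec_conv₂ {k₁ k₂ : ℤ} (j : ℤ) {f₁ f₂ : THom K V₀ V₁ W₀ W₁}
    (h₁ : f₁ ∈ convDeg K V₀ V₁ W₀ W₁ k₁) (h₂ : f₂ ∈ convDeg K V₀ V₁ W₀ W₁ k₂)
    (c : Kˣ) (w : Tens K V₀ V₁) :
    TensorProduct.map (scaleVec (c : K)) (scaleVec (c : K)) (conv₂ j f₁ f₂ w)
      = (c : K) ^ (k₁ + k₂) • conv₂ j f₁ f₂ (scaleWord (c : K) w) := by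
  rw [mem_convDeg_iff] at h₁ h₂
  rw [conv₂_apply, conv₂_apply, coprod_scaleWord]
  generalize coprod w = z
  induction z using TensorProduct.induction_on with
  | zero => simp only [map_zero, smul_zero]
  | add x y hx hy => simp only [map_add, hx, hy, smul_add]
  | tmul a b =>
    simp only [TensorProduct.map_tmul, LinearMap.comp_apply, AlgHom.toLinearMap_apply, h₁.2, h₂.2,
      koszul_scaleWord, TensorProduct.smul_tmul_smul, zpow_add₀ c.ne_zero]

theorem map_scaleVec_conv₃ {k₁ k₂ k₃ : ℤ} (j j' : ℤ) {f₁ f₂ f₃ : THom K V₀ V₁ W₀ W₁}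
    (h₁ : f₁ ∈ convDeg K V₀ V₁ W₀ W₁ k₁) (h₂ : f₂ ∈ convDeg K V₀ V₁ W₀ W₁ k₂)
    (h₃ : f₃ ∈ convDeg K V₀ V₁ W₀ W₁ k₃) (c : Kˣ) (w : Tens K V₀ V₁) :
    TensorProduct.map (scaleVec (c : K))
        (TensorProduct.map (scaleVec (c : K)) (scaleVec (c : K))) (conv₃ j j' f₁ f₂ f₃ w)
      = (c : K) ^ (k₁ + k₂ + k₃) • conv₃ j j' f₁ f₂ f₃ (scaleWord (c : K) w) := by
  have h₁₂ := map_scaleVec_conv₂ j h₁ h₂ c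
  rw [mem_convDeg_iff] at h₃
  rw [conv₃_apply, conv₃_apply, coprod_scaleWord, TensorProduct.map_map_assoc, ← map_smul]
  congr 1
  generalize coprod w = z
  induction z using TensorProduct.induction_on with
  | zero => simp only [map_zero, smul_zero]
  | add x y hx hy => simp only [map_add, hx, hy, smul_add]
  | tmul a b =>
    simp only [TensorProduct.map_tmul, LinearMap.comp_apply, AlgHom.toLinearMap_apply, h₁₂, h₃.2,
      koszul_scaleWord, TensorProduct.smul_tmul_smul, zpow_add₀ c.ne_zero]

theorem bracket₂_mem (W : TwoTermLeibniz K W₀ W₁) {k₁ k₂ : ℤ} {f₁ f₂ : THom K V₀ V₁ W₀ W₁}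
    (h₁ : f₁ ∈ convDeg K V₀ V₁ W₀ W₁ k₁) (h₂ : f₂ ∈ convDeg K V₀ V₁ W₀ W₁ k₂) :
    bracket₂ W k₁ k₂ f₁ f₂ ∈ convDeg K V₀ V₁ W₀ W₁ (k₁ + k₂) := by
  refine mem_convDeg_iff.2 ⟨by simp [bracket₂_apply, conv₂_apply, coprod_one], fun c w => ?_⟩
  simp only [bracket₂_apply, map_sub, map_smul, ← W.t₂_map_scaleVec, map_scaleVec_conv₂ _ h₁ h₂,
    map_scaleVec_conv₂ _ h₂ h₁, add_comm k₂ k₁]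
  module

theorem bracket₃_mem (W : TwoTermLeibniz K W₀ W₁) {k₁ k₂ k₃ : ℤ}
    {f₁ f₂ f₃ : THom K V₀ V₁ W₀ W₁}
    (h₁ : f₁ ∈ convDeg K V₀ V₁ W₀ W₁ k₁) (h₂ : f₂ ∈ convDeg K V₀ V₁ W₀ W₁ k₂)
    (h₃ : f₃ ∈ convDeg K V₀ V₁ W₀ W₁ k₃) :
    bracket₃ W k₁ k₂ k₃ f₁ f₂ f₃ ∈ convDeg K V₀ V₁ W₀ W₁ (k₁ + k₂ + k₃ + 1) := by
  refine mem_convDeg_iff.2 ⟨by simp [bracket₃_apply, conv₃_apply, coprod_one], fun c w => ?_⟩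
  have h₂₁₃ : k₂ + k₁ + k₃ = k₁ + k₂ + k₃ := by ring
  have h₁₃₂ : k₁ + k₃ + k₂ = k₁ + k₂ + k₃ := by ring
  have h₂₃₁ : k₂ + k₃ + k₁ = k₁ + k₂ + k₃ := by ring
  have h₃₁₂ : k₃ + k₁ + k₂ = k₁ + k₂ + k₃ := by ring
  have h₃₂₁ : k₃ + k₂ + k₁ = k₁ + k₂ + k₃ := by ring
  simp only [bracket₃_apply, map_sub, map_add, map_smul, ← W.smul_t₃_map_scaleVec,
    map_scaleVec_conv₃ _ _ h₁ h₂ h₃, map_scaleVec_conv₃ _ _ h₂ h₁ h₃,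
    map_scaleVec_conv₃ _ _ h₁ h₃ h₂, map_scaleVec_conv₃ _ _ h₂ h₃ h₁,
    map_scaleVec_conv₃ _ _ h₃ h₁ h₂, map_scaleVec_conv₃ _ _ h₃ h₂ h₁,
    h₂₁₃, h₁₃₂, h₂₃₁, h₃₁₂, h₃₂₁, zpow_add_one₀ c.ne_zero]
  module

end Convolution

/-! ### Structure maps on short words -/

section ShortWords

variable {K V₀ V₁ : Type*} [Field K] [AddCommGroup V₀] [Module K V₀] [AddCommGroup V₁]
  [Module K V₁]

theorem red_ι (v : V₀ × V₁) : red (ι K v) = ι K v := by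
  simpa using red_ι_mul (K := K) v 1

theorem coprod_ι (v : V₀ × V₁) : coprod (ι K v) = 0 := by
  simpa [red_one, coprod_one] using coprod_ι_mul (K := K) v 1

theorem coprod_ι_mul_ι (u v : V₀ × V₁) : coprod (ι K u * ι K v) = ι K u ⊗ₜ[K] ι K v := by
  simp [coprod_ι_mul, coprod_ι, red_ι]

theorem koszul_inl (k : ℤ) (x : V₀) :
    koszul k (ι K (x, (0 : V₁))) = (-1 : K) ^ k • ι K (x, (0 : V₁)) := by
  rw [koszul_ι, ← map_smul, Prod.smul_mk, smul_zero]

theorem coprod_inl_mul_inl_mul_inl (x y z : V₀) :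
    coprod (ι K (x, (0 : V₁)) * (ι K (y, (0 : V₁)) * ι K (z, (0 : V₁))))
      = ι K (x, (0 : V₁)) ⊗ₜ[K] (ι K (y, (0 : V₁)) * ι K (z, (0 : V₁)))
        + (ι K (x, (0 : V₁)) * ι K (y, (0 : V₁))) ⊗ₜ[K] ι K (z, (0 : V₁))
        - ι K (y, (0 : V₁)) ⊗ₜ[K] (ι K (x, (0 : V₁)) * ι K (z, (0 : V₁))) := by
  simp [coprod_ι_mul (x, (0 : V₁)), coprod_ι_mul_ι, red_ι_mul, koszul_inl, ← Prod.zero_eq_mk,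
    TensorProduct.neg_tmul, sub_eq_add_neg]

theorem deconc_ι (v : V₀ × V₁) : deconc (ι K v) = 1 ⊗ₜ[K] ι K v + ι K v ⊗ₜ[K] 1 := by
  simpa [deconc_one] using deconc_ι_mul (K := K) v 1

theorem algebraMapInv_ι_mul (v : V₀ × V₁) (w : Tens K V₀ V₁) :
    TensorAlgebra.algebraMapInv (ι K v * w) = 0 := by
  simp [TensorAlgebra.algebraMapInv]

theorem algebraMapInv_ι (v : V₀ × V₁) : TensorAlgebra.algebraMapInv (ι K v) = 0 := by
  simp [TensorAlgebra.algebraMapInv]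

theorem proj₁_ι (v : V₀ × V₁) : proj₁ (ι K v) = v := by
  simpa using proj₁_ι_mul (K := K) v 1

theorem proj₂_ι (v : V₀ × V₁) : proj₂ (ι K v) = 0 := by
  simpa [proj₁_one] using proj₂_ι_mul (K := K) v 1

theorem proj₃_ι (v : V₀ × V₁) : proj₃ (ι K v) = 0 := by
  simpa [proj₂_one] using proj₃_ι_mul (K := K) v 1

namespace TwoTermLeibniz

variable (V : TwoTermLeibniz K V₀ V₁)

theorem corestr_ι (u : V₀ × V₁) : V.corestr (ι K u) = V.t₁ u := by
  simp [corestr, proj₁_ι, proj₂_ι, proj₃_ι]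

theorem corestr_ι_mul_ι (u v : V₀ × V₁) :
    V.corestr (ι K u * ι K v) = V.t₂ (parity (K := K) u ⊗ₜ v) := by
  simp [corestr, proj₁_ι_mul, proj₂_ι_mul, proj₃_ι_mul, proj₁_ι, proj₂_ι, algebraMapInv_ι]

theorem corestr_ι_mul_ι_mul_ι (u v w : V₀ × V₁) :
    V.corestr (ι K u * (ι K v * ι K w)) = V.t₃ (u ⊗ₜ (v ⊗ₜ w)) := by
  simp [corestr, proj₁_ι_mul, proj₂_ι_mul, proj₃_ι_mul, proj₁_ι, algebraMapInv_ι,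
    algebraMapInv_ι_mul]

theorem codiffInit_one : V.codiffInit 1 = 0 := by
  simp [codiffInit, coprodPlus, coprod_one, red_one]

theorem codiffInit_ι (u : V₀ × V₁) : V.codiffInit (ι K u) = ι K (V.t₁ u) := by
  simp [codiffInit, coprodPlus, coprod_ι, red_ι, corestr_ι]

theorem codiffInit_ι_mul_ι (u v : V₀ × V₁) : V.codiffInit (ι K u * ι K v)
    = koszul (-1) (ι K u) * ι K (V.t₁ v) + ι K (V.t₂ (parity (K := K) u ⊗ₜ v)) := by
  simp [codiffInit, coprodPlus, coprod_ι_mul_ι, red_ι_mul, corestr_ι, corestr_ι_mul_ι]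

theorem codiff_ι (u : V₀ × V₁) : V.codiff (ι K u) = ι K (V.t₁ u) := by
  simp [codiff_eq, deconc_ι, codiffInit_one, codiffInit_ι]

theorem codiff_ι_mul_ι (u v : V₀ × V₁) : V.codiff (ι K u * ι K v)
    = ι K (V.t₁ u) * ι K v + koszul (-1) (ι K u) * ι K (V.t₁ v)
      + ι K (V.t₂ (parity (K := K) u ⊗ₜ v)) := by
  simp [codiff_eq, deconc_ι, deconc_ι_mul, codiffInit_one, codiffInit_ι, codiffInit_ι_mul_ι,
    add_assoc]

theorem codiff_inl_mul_inl_mul_inl (x y z : V₀) :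
    V.codiff (ι K (x, (0 : V₁)) * (ι K (y, (0 : V₁)) * ι K (z, (0 : V₁))))
      = ι K (V.l₂ x y, (0 : V₁)) * ι K (z, (0 : V₁))
        - ι K (x, (0 : V₁)) * ι K (V.l₂ y z, (0 : V₁))
        + ι K (y, (0 : V₁)) * ι K (V.l₂ x z, (0 : V₁))
        + ι K ((0 : V₀), V.l₃ x y z) := by
  have hinit : V.codiffInit (ι K (x, (0 : V₁)) * (ι K (y, (0 : V₁)) * ι K (z, (0 : V₁))))
      = -(ι K (x, (0 : V₁)) * ι K (V.l₂ y z, (0 : V₁)))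
        + ι K (y, (0 : V₁)) * ι K (V.l₂ x z, (0 : V₁)) + ι K ((0 : V₀), V.l₃ x y z) := by
    simp [codiffInit, coprodPlus, coprod_inl_mul_inl_mul_inl, red_ι_mul, koszul_inl, corestr_ι,
      corestr_ι_mul_ι, corestr_ι_mul_ι_mul_ι, t₁_apply, t₂_tmul, t₃_tmul, parity,
      ← Prod.zero_eq_mk]
  simp [codiff_eq, deconc_ι, deconc_ι_mul, codiffInit_one, codiffInit_ι, codiffInit_ι_mul_ι, hinit,
    t₁_apply, t₂_tmul, parity, ← Prod.zero_eq_mk, sub_eq_add_neg, add_assoc]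

end TwoTermLeibniz

end ShortWords

/-! ### Elements of low degree of the convolution algebra -/

section WordDeg

variable {V₀ V₁ : Type*} {l : List (V₀ ⊕ V₁)} {n : ℤ}

theorem wordDeg_nonneg (l : List (V₀ ⊕ V₁)) : 0 ≤ wordDeg l := by
  induction l with
  | nil => exact wordDeg_nil.ge
  | cons a l ih =>
    rw [wordDeg_cons]
    cases a <;> simp only [letterDeg] <;> omega

theorem eq_inl_cons_or_eq_inr_cons (hn : 0 < n) (hl : wordDeg l = n) :
    (∃ x m, l = .inl x :: m ∧ wordDeg m = n - 1) ∨
      ∃ h m, l = .inr h :: m ∧ wordDeg m = n - 2 := by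
  match l with
  | [] => rw [wordDeg_nil] at hl; omega
  | .inl x :: m => rw [wordDeg_cons, letterDeg] at hl; exact .inl ⟨x, m, rfl, by omega⟩
  | .inr h :: m => rw [wordDeg_cons, letterDeg] at hl; exact .inr ⟨h, m, rfl, by omega⟩

theorem eq_nil_of_wordDeg_eq_zero (hl : wordDeg l = 0) : l = [] := by
  match l with
  | [] => rfl
  | a :: m =>
    have := wordDeg_nonneg m
    rw [wordDeg_cons] at hl
    cases a <;> simp only [letterDeg] at hl <;> omega

theorem eq_of_wordDeg_eq_one (hl : wordDeg l = 1) : ∃ x, l = [.inl x] := by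
  obtain ⟨x, m, rfl, hm⟩ | ⟨h, m, rfl, hm⟩ := eq_inl_cons_or_eq_inr_cons one_pos hl
  · exact ⟨x, by rw [eq_nil_of_wordDeg_eq_zero hm]⟩
  · have := wordDeg_nonneg m
    omega

theorem eq_of_wordDeg_eq_two (hl : wordDeg l = 2) :
    (∃ h, l = [.inr h]) ∨ ∃ x y, l = [.inl x, .inl y] := by
  obtain ⟨x, m, rfl, hm⟩ | ⟨h, m, rfl, hm⟩ := eq_inl_cons_or_eq_inr_cons two_pos hl
  · obtain ⟨y, rfl⟩ := eq_of_wordDeg_eq_one hm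
    exact .inr ⟨x, y, rfl⟩
  · exact .inl ⟨h, by rw [eq_nil_of_wordDeg_eq_zero hm]⟩

theorem eq_of_wordDeg_eq_three (hl : wordDeg l = 3) :
    (∃ x h, l = [.inl x, .inr h]) ∨ (∃ h x, l = [.inr h, .inl x]) ∨
      ∃ x y z, l = [.inl x, .inl y, .inl z] := by
  obtain ⟨x, m, rfl, hm⟩ | ⟨h, m, rfl, hm⟩ := eq_inl_cons_or_eq_inr_cons three_pos hl
  · obtain ⟨h, rfl⟩ | ⟨y, z, rfl⟩ := eq_of_wordDeg_eq_two hm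
    exacts [.inl ⟨x, h, rfl⟩, .inr (.inr ⟨x, y, z, rfl⟩)]
  · obtain ⟨x, rfl⟩ := eq_of_wordDeg_eq_one hm
    exact .inr (.inl ⟨h, x, rfl⟩)

end WordDeg

section Convolution

variable {K V₀ V₁ W₀ W₁ : Type*} [Field K]
  [AddCommGroup V₀] [Module K V₀] [AddCommGroup V₁] [Module K V₁]
  [AddCommGroup W₀] [Module K W₀] [AddCommGroup W₁] [Module K W₁]
  {f g : THom K V₀ V₁ W₀ W₁}

theorem convDeg_ext {k : ℤ} (hf : f ∈ convDeg K V₀ V₁ W₀ W₁ k)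
    (hg : g ∈ convDeg K V₀ V₁ W₀ W₁ k)
    (h₀ : ∀ l, wordDeg l = -k → (f (word l)).1 = (g (word l)).1)
    (h₁ : ∀ l, wordDeg l = 1 - k → (f (word l)).2 = (g (word l)).2) : f = g := by
  refine tens_linearMap_ext_word fun l => Prod.ext ?_ ?_
  · by_cases hl : wordDeg l + k = 0
    · exact h₀ l (by omega)
    · rw [(hf.2 l).1 hl, (hg.2 l).1 hl]
  · by_cases hl : wordDeg l + k = 1
    · exact h₁ l (by omega)
    · rw [(hf.2 l).2 hl, (hg.2 l).2 hl]

theorem convDeg_zero_ext (hf : f ∈ convDeg K V₀ V₁ W₀ W₁ 0) (hg : g ∈ convDeg K V₀ V₁ W₀ W₁ 0)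
    (x : ∀ x, (f (ι K (x, 0))).2 = (g (ι K (x, 0))).2) : f = g := by
  refine convDeg_ext hf hg (fun l hl => ?_) fun l hl => ?_
  · rw [eq_nil_of_wordDeg_eq_zero hl, word_nil, hf.1, hg.1]
  · obtain ⟨a, rfl⟩ := eq_of_wordDeg_eq_one hl
    simpa [word, letter] using x a

theorem convDeg_neg_one_ext (hf : f ∈ convDeg K V₀ V₁ W₀ W₁ (-1))
    (hg : g ∈ convDeg K V₀ V₁ W₀ W₁ (-1)) (x : ∀ x, (f (ι K (x, 0))).1 = (g (ι K (x, 0))).1)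
    (h : ∀ h, (f (ι K (0, h))).2 = (g (ι K (0, h))).2)
    (xy : ∀ x y, (f (ι K (x, 0) * ι K (y, 0))).2 = (g (ι K (x, 0) * ι K (y, 0))).2) : f = g := by
  refine convDeg_ext hf hg (fun l hl => ?_) fun l hl => ?_
  · obtain ⟨a, rfl⟩ := eq_of_wordDeg_eq_one hl
    simpa [word, letter] using x a
  · obtain ⟨k, rfl⟩ | ⟨a, b, rfl⟩ := eq_of_wordDeg_eq_two hl
    · simpa [word, letter] using h k
    · simpa [word, letter] using xy a b

theorem eq_zero_of_mem_convDeg_neg_two (hf : f ∈ convDeg K V₀ V₁ W₀ W₁ (-2))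
    (h : ∀ h, (f (ι K (0, h))).1 = 0) (xy : ∀ x y, (f (ι K (x, 0) * ι K (y, 0))).1 = 0)
    (xh : ∀ x h, (f (ι K (x, 0) * ι K (0, h))).2 = 0)
    (hx : ∀ h x, (f (ι K (0, h) * ι K (x, 0))).2 = 0)
    (xyz : ∀ x y z, (f (ι K (x, 0) * (ι K (y, 0) * ι K (z, 0)))).2 = 0) : f = 0 := by
  refine convDeg_ext hf (Submodule.zero_mem _) (fun l hl => ?_) fun l hl => ?_
  · obtain ⟨k, rfl⟩ | ⟨a, b, rfl⟩ := eq_of_wordDeg_eq_two hl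
    · simpa [word, letter] using h k
    · simpa [word, letter] using xy a b
  · obtain ⟨a, k, rfl⟩ | ⟨k, a, rfl⟩ | ⟨a, b, c, rfl⟩ := eq_of_wordDeg_eq_three hl
    · simpa [word, letter] using xh a k
    · simpa [word, letter] using hx k a
    · simpa [word, letter] using xyz a b c

/-- The element of degree `-1` of `L(V, W)` with the components `a : V₀ → W₀`, `b : V₁ → W₁` and
`c : V₀ × V₀ → W₁`; every element of degree `-1` is of this form. -/
def ofComponents (a : V₀ →ₗ[K] W₀) (b : V₁ →ₗ[K] W₁) (c : V₀ →ₗ[K] V₀ →ₗ[K] W₁) :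
    THom K V₀ V₁ W₀ W₁ :=
  LinearMap.prodMap a b ∘ₗ proj₁ +
    LinearMap.inr K W₀ W₁ ∘ₗ TensorProduct.lift c ∘ₗ
      TensorProduct.map (LinearMap.fst K V₀ V₁) (LinearMap.fst K V₀ V₁) ∘ₗ proj₂

/-- The element of degree `0` of `L(V, W)` with the component `θ : V₀ → W₁`. -/
def ofParam (θ : V₀ →ₗ[K] W₁) : THom K V₀ V₁ W₀ W₁ :=
  LinearMap.inr K W₀ W₁ ∘ₗ θ ∘ₗ LinearMap.fst K V₀ V₁ ∘ₗ proj₁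

/-- The component `V₀ → W₁` of an element of `L(V, W)`, which determines the elements of degree
`0`. -/
def param : THom K V₀ V₁ W₀ W₁ →ₗ[K] V₀ →ₗ[K] W₁ where
  toFun F := LinearMap.snd K W₀ W₁ ∘ₗ F ∘ₗ ι K ∘ₗ LinearMap.inl K V₀ V₁
  map_add' _ _ := rfl
  map_smul' _ _ := rfl

section Values

variable (a : V₀ →ₗ[K] W₀) (b : V₁ →ₗ[K] W₁) (c : V₀ →ₗ[K] V₀ →ₗ[K] W₁) (θ : V₀ →ₗ[K] W₁)

theorem ofComponents_one : ofComponents a b c 1 = 0 := by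
  simp [ofComponents, proj₁_one, proj₂_one]

theorem ofComponents_ι (u : V₀ × V₁) : ofComponents a b c (ι K u) = (a u.1, b u.2) := by
  simp [ofComponents, proj₁_ι, proj₂_ι]

theorem ofComponents_ι_mul_ι (u v : V₀ × V₁) :
    ofComponents a b c (ι K u * ι K v) = (0, c u.1 v.1) := by
  simp [ofComponents, proj₁_ι_mul, proj₂_ι_mul, proj₁_ι, algebraMapInv_ι]

theorem ofComponents_ι_mul_ι_mul_ι (u v w : V₀ × V₁) :
    ofComponents a b c (ι K u * (ι K v * ι K w)) = 0 := by
  simp [ofComponents, proj₁_ι_mul, proj₂_ι_mul, algebraMapInv_ι, algebraMapInv_ι_mul]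

theorem ofParam_one : (ofParam θ : THom K V₀ V₁ W₀ W₁) 1 = 0 := by
  simp [ofParam, proj₁_one]

theorem ofParam_ι (u : V₀ × V₁) : (ofParam θ : THom K V₀ V₁ W₀ W₁) (ι K u) = (0, θ u.1) := by
  simp [ofParam, proj₁_ι]

theorem param_apply (F : THom K V₀ V₁ W₀ W₁) (x : V₀) : param F x = (F (ι K (x, 0))).2 := rfl

theorem param_ofParam : param (ofParam θ : THom K V₀ V₁ W₀ W₁) = θ := by
  ext x
  rw [param_apply, ofParam_ι]

theorem ofParam_ι_mul_ι (u v : V₀ × V₁) :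
    (ofParam θ : THom K V₀ V₁ W₀ W₁) (ι K u * ι K v) = 0 := by
  simp [ofParam, proj₁_ι_mul, algebraMapInv_ι]

end Values

variable [Infinite K]

theorem ofComponents_mem (a : V₀ →ₗ[K] W₀) (b : V₁ →ₗ[K] W₁) (c : V₀ →ₗ[K] V₀ →ₗ[K] W₁) :
    ofComponents a b c ∈ convDeg K V₀ V₁ W₀ W₁ (-1) := by
  rw [mem_convDeg_iff]
  refine ⟨ofComponents_one a b c, fun r w => Prod.ext ?_ ?_⟩
  · simp [ofComponents, proj₁_scaleWord, scaleVec_apply]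
  · have hfst : LinearMap.fst K V₀ V₁ ∘ₗ scaleVec (r : K) = LinearMap.fst K V₀ V₁ := rfl
    simp [ofComponents, proj₁_scaleWord, proj₂_scaleWord, scaleVec_apply, TensorProduct.map_map,
      hfst, smul_smul, pow_two]

theorem ofParam_mem (θ : V₀ →ₗ[K] W₁) :
    (ofParam θ : THom K V₀ V₁ W₀ W₁) ∈ convDeg K V₀ V₁ W₀ W₁ 0 := by
  rw [mem_convDeg_iff]
  refine ⟨ofParam_one θ, fun c w => ?_⟩
  simp [ofParam, proj₁_scaleWord, scaleVec_apply]

theorem exists_eq_ofComponents (hf : f ∈ convDeg K V₀ V₁ W₀ W₁ (-1)) :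
    ∃ a b c, f = ofComponents a b c := by
  refine ⟨LinearMap.fst K W₀ W₁ ∘ₗ f ∘ₗ ι K ∘ₗ LinearMap.inl K V₀ V₁,
    LinearMap.snd K W₀ W₁ ∘ₗ f ∘ₗ ι K ∘ₗ LinearMap.inr K V₀ V₁,
    ((LinearMap.mul K (Tens K V₀ V₁)).compl₁₂ (ι K ∘ₗ LinearMap.inl K V₀ V₁)
      (ι K ∘ₗ LinearMap.inl K V₀ V₁)).compr₂ (LinearMap.snd K W₀ W₁ ∘ₗ f),
    convDeg_neg_one_ext hf (ofComponents_mem _ _ _) ?_ ?_ ?_⟩ <;>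
  intros <;> simp [ofComponents_ι, ofComponents_ι_mul_ι]

theorem ofParam_param (hf : f ∈ convDeg K V₀ V₁ W₀ W₁ 0) : ofParam (param f) = f := by
  refine convDeg_zero_ext (ofParam_mem _) hf fun x => ?_
  rw [ofParam_ι, param_apply]

end Convolution

/-! ### The Maurer-Cartan equation in components -/

section Components

variable {K V₀ V₁ W₀ W₁ : Type*} [Field K]
  [AddCommGroup V₀] [Module K V₀] [AddCommGroup V₁] [Module K V₁]
  [AddCommGroup W₀] [Module K W₀] [AddCommGroup W₁] [Module K W₁]

variable (V : TwoTermLeibniz K V₀ V₁) (W : TwoTermLeibniz K W₀ W₁)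

/-- The left hand side of the Maurer-Cartan equation for an element `F` of degree `-1` of `L(V, W)`.
This is the part of form degree `0` of the curvature of `F + B dt`. -/
def convCurvature (F : THom K V₀ V₁ W₀ W₁) : THom K V₀ V₁ W₀ W₁ :=
  bracket₁ V W (-1) F - (1 / 2 : K) • bracket₂ W (-1) (-1) F F
    - (1 / 6 : K) • bracket₃ W (-1) (-1) (-1) F F F

/-- The differential of `L(V, W)` twisted by `F`, applied to an element `B` of degree `0`. The part
of form degree `1` of the curvature of `F + B dt` is the difference of this element and of `F'`. -/
def twistedDiff (F B : THom K V₀ V₁ W₀ W₁) : THom K V₀ V₁ W₀ W₁ :=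
  bracket₁ V W 0 B
    - (1 / 2 : K) • (bracket₂ W (-1) 0 F B - bracket₂ W 0 (-1) B F)
    - (1 / 6 : K) • (bracket₃ W (-1) (-1) 0 F F B - bracket₃ W (-1) 0 (-1) F B F
      + bracket₃ W 0 (-1) (-1) B F F)

section Degree

variable {V W} [Infinite K] {F B : THom K V₀ V₁ W₀ W₁}

theorem convCurvature_mem (hF : F ∈ convDeg K V₀ V₁ W₀ W₁ (-1)) :
    convCurvature V W F ∈ convDeg K V₀ V₁ W₀ W₁ (-2) := by
  have h₁ := bracket₁_mem V W hF
  have h₂ := bracket₂_mem W hF hF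
  have h₃ := bracket₃_mem W hF hF hF
  norm_num only at h₁ h₂ h₃
  exact sub_mem (sub_mem h₁ (Submodule.smul_mem _ _ h₂)) (Submodule.smul_mem _ _ h₃)

theorem twistedDiff_mem (hF : F ∈ convDeg K V₀ V₁ W₀ W₁ (-1))
    (hB : B ∈ convDeg K V₀ V₁ W₀ W₁ 0) : twistedDiff V W F B ∈ convDeg K V₀ V₁ W₀ W₁ (-1) := by
  have h₁ := bracket₁_mem V W hB
  have h₂ := bracket₂_mem W hF hB
  have h₃ := bracket₂_mem W hB hF
  have h₄ := bracket₃_mem W hF hF hB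
  have h₅ := bracket₃_mem W hF hB hF
  have h₆ := bracket₃_mem W hB hF hF
  norm_num only at h₁ h₂ h₃ h₄ h₅ h₆
  exact sub_mem (sub_mem h₁ (Submodule.smul_mem _ _ (sub_mem h₂ h₃)))
    (Submodule.smul_mem _ _ (add_mem (sub_mem h₄ h₅) h₆))

end Degree

section ShortWords

variable (F G H : THom K V₀ V₁ W₀ W₁) (k k' : ℤ)

theorem conv₂_ι (u : V₀ × V₁) : conv₂ k F G (ι K u) = 0 := by
  rw [conv₂_apply, coprod_ι, map_zero]

theorem conv₂_ι_mul_ι (u v : V₀ × V₁) :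
    conv₂ k F G (ι K u * ι K v) = F (ι K ((-1 : K) ^ k • u.1, u.2)) ⊗ₜ G (ι K v) := by
  simp [conv₂_apply, coprod_ι_mul_ι, koszul_ι]

theorem conv₃_ι (u : V₀ × V₁) : conv₃ k k' F G H (ι K u) = 0 := by
  rw [conv₃_apply, coprod_ι, map_zero, map_zero]

theorem conv₃_ι_mul_ι (u v : V₀ × V₁) : conv₃ k k' F G H (ι K u * ι K v) = 0 := by
  simp [conv₃_apply, coprod_ι_mul_ι, koszul_ι, conv₂_ι]

theorem conv₂_inl_mul_inl_mul_inl (x y z : V₀) :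
    conv₂ (-1) F G (ι K (x, (0 : V₁)) * (ι K (y, (0 : V₁)) * ι K (z, (0 : V₁))))
      = F (ι K (x, 0) * ι K (y, 0)) ⊗ₜ G (ι K (z, 0))
        - F (ι K (x, 0)) ⊗ₜ G (ι K (y, 0) * ι K (z, 0))
        + F (ι K (y, 0)) ⊗ₜ G (ι K (x, 0) * ι K (z, 0)) := by
  simp [conv₂_apply, coprod_inl_mul_inl_mul_inl, koszul_inl, TensorProduct.neg_tmul,
    neg_add_eq_sub]

theorem conv₃_inl_mul_inl_mul_inl (x y z : V₀) :
    conv₃ (-1) (-1) F G H (ι K (x, (0 : V₁)) * (ι K (y, (0 : V₁)) * ι K (z, (0 : V₁))))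
      = -(F (ι K (x, 0)) ⊗ₜ (G (ι K (y, 0)) ⊗ₜ H (ι K (z, 0)))) := by
  have h (x : V₀) : ι K (-x, (0 : V₁)) = -ι K (x, 0) := by rw [← map_neg, Prod.neg_mk, neg_zero]
  simp [conv₃_apply, coprod_inl_mul_inl_mul_inl, koszul_inl, conv₂_ι, conv₂_ι_mul_ι, h,
    ← TensorProduct.neg_tmul]

end ShortWords

variable [CharZero K]

theorem half_smul_bracket₂_self (F : THom K V₀ V₁ W₀ W₁) (w : Tens K V₀ V₁) :
    (1 / 2 : K) • bracket₂ W (-1) (-1) F F w = W.t₂ (conv₂ (-1) F F w) := by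
  rw [bracket₂_apply, show (-1 : ℤ) * -1 = 1 by norm_num, zpow_one]
  module

theorem sixth_smul_bracket₃_self (F : THom K V₀ V₁ W₀ W₁) (w : Tens K V₀ V₁) :
    (1 / 6 : K) • bracket₃ W (-1) (-1) (-1) F F F w = W.t₃ (conv₃ (-1) (-1) F F F w) := by
  have h₂ : (-1 : K) ^ (2 : ℤ) = 1 := by norm_num
  have h₃ : (-1 : K) ^ (3 : ℤ) = -1 := by norm_num
  rw [bracket₃_apply, show (-1 : ℤ) * -1 = 1 by norm_num, show (1 : ℤ) + 1 = 2 by norm_num,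
    show (2 : ℤ) + 1 = 3 by norm_num, zpow_one, h₂, h₃]
  module

theorem convCurvature_apply (F : THom K V₀ V₁ W₀ W₁) (w : Tens K V₀ V₁) :
    convCurvature V W F w = W.t₁ (F w) - F (V.codiff w) - W.t₂ (conv₂ (-1) F F w)
      - W.t₃ (conv₃ (-1) (-1) F F F w) := by
  rw [convCurvature, LinearMap.sub_apply, LinearMap.sub_apply, LinearMap.smul_apply,
    LinearMap.smul_apply, half_smul_bracket₂_self, sixth_smul_bracket₃_self, bracket₁_apply,
    zpow_neg_one, inv_neg_one, neg_one_smul, ← sub_eq_add_neg]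

variable (a : V₀ →ₗ[K] W₀) (b : V₁ →ₗ[K] W₁) (c : V₀ →ₗ[K] V₀ →ₗ[K] W₁) (θ : V₀ →ₗ[K] W₁)

theorem convCurvature_ofComponents_inr (h : V₁) :
    convCurvature V W (ofComponents a b c) (ι K (0, h)) = (W.l₁ (b h) - a (V.l₁ h), 0) := by
  simp [convCurvature_apply, conv₂_ι, conv₃_ι, V.codiff_ι, ofComponents_ι,
    TwoTermLeibniz.t₁_apply]

theorem convCurvature_ofComponents_inl_mul_inl (x y : V₀) :
    convCurvature V W (ofComponents a b c) (ι K (x, 0) * ι K (y, 0))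
      = (W.l₂ (a x) (a y) + W.l₁ (c x y) - a (V.l₂ x y), 0) := by
  simp [convCurvature_apply, conv₂_ι_mul_ι, conv₃_ι_mul_ι, V.codiff_ι_mul_ι, ofComponents_ι,
    ofComponents_ι_mul_ι, TwoTermLeibniz.t₁_apply, koszul_inl, TwoTermLeibniz.t₂_tmul, parity,
    sub_eq_add_neg, add_comm, add_left_comm]

theorem convCurvature_ofComponents_inl_mul_inr (x : V₀) (h : V₁) :
    convCurvature V W (ofComponents a b c) (ι K (x, 0) * ι K (0, h))
      = (0, W.l₂r (a x) (b h) - (b (V.l₂r x h) - c x (V.l₁ h))) := by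
  simp [convCurvature_apply, conv₂_ι_mul_ι, conv₃_ι_mul_ι, V.codiff_ι_mul_ι, ofComponents_ι,
    ofComponents_ι_mul_ι, TwoTermLeibniz.t₁_apply, koszul_inl, TwoTermLeibniz.t₂_tmul, parity,
    sub_eq_add_neg, add_comm]

theorem convCurvature_ofComponents_inr_mul_inl (h : V₁) (x : V₀) :
    convCurvature V W (ofComponents a b c) (ι K (0, h) * ι K (x, 0))
      = (0, b (V.l₂l h x) - c (V.l₁ h) x - W.l₂l (b h) (a x)) := by
  simp [convCurvature_apply, conv₂_ι_mul_ι, conv₃_ι_mul_ι, V.codiff_ι_mul_ι, ofComponents_ι,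
    ofComponents_ι_mul_ι, TwoTermLeibniz.t₁_apply, TwoTermLeibniz.t₂_tmul, parity,
    sub_eq_add_neg, ← Prod.zero_eq_mk]

theorem convCurvature_ofComponents_inl_mul_inl_mul_inl (x y z : V₀) :
    convCurvature V W (ofComponents a b c) (ι K (x, 0) * (ι K (y, 0) * ι K (z, 0)))
      = (0, W.l₃ (a x) (a y) (a z) - W.l₂l (c x y) (a z) + W.l₂r (a x) (c y z)
        - W.l₂r (a y) (c x z)
        - (b (V.l₃ x y z) + c (V.l₂ x y) z - c x (V.l₂ y z) + c y (V.l₂ x z))) := by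
  simp only [convCurvature_apply, ofComponents_ι_mul_ι_mul_ι, map_zero,
    V.codiff_inl_mul_inl_mul_inl, map_add, map_sub, ofComponents_ι_mul_ι,
    Prod.mk_sub_mk, sub_self, Prod.mk_add_mk, add_zero, ofComponents_ι, zero_sub, neg_add_rev,
    neg_sub, Int.reduceNeg, conv₂_inl_mul_inl_mul_inl, TwoTermLeibniz.t₂_tmul, LinearMap.zero_apply,
    zero_add, conv₃_inl_mul_inl_mul_inl, map_neg, TwoTermLeibniz.t₃_tmul, Prod.neg_mk, neg_zero,
    sub_neg_eq_add, Prod.mk.injEq, true_and]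
  abel

theorem convCurvature_ofComponents_eq_zero_iff :
    convCurvature V W (ofComponents a b c) = 0 ↔
      (∀ h, W.l₁ (b h) = a (V.l₁ h)) ∧
      (∀ x y, W.l₂ (a x) (a y) + W.l₁ (c x y) = a (V.l₂ x y)) ∧
      (∀ x h, W.l₂r (a x) (b h) = b (V.l₂r x h) - c x (V.l₁ h)) ∧
      (∀ h x, W.l₂l (b h) (a x) = b (V.l₂l h x) - c (V.l₁ h) x) ∧
      ∀ x y z, W.l₃ (a x) (a y) (a z) - W.l₂l (c x y) (a z) + W.l₂r (a x) (c y z)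
          - W.l₂r (a y) (c x z)
        = b (V.l₃ x y z) + c (V.l₂ x y) z - c x (V.l₂ y z) + c y (V.l₂ x z) := by
  refine ⟨fun e => ⟨fun h => ?_, fun x y => ?_, fun x h => ?_, fun h x => ?_, fun x y z => ?_⟩,
    fun ⟨h₁, h₂, h₃, h₄, h₅⟩ => eq_zero_of_mem_convDeg_neg_two
      (convCurvature_mem (ofComponents_mem a b c)) ?_ ?_ ?_ ?_ ?_⟩
  · have := convCurvature_ofComponents_inr V W a b c h
    rw [e] at this
    exact sub_eq_zero.1 (congrArg Prod.fst this).symm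
  · have := convCurvature_ofComponents_inl_mul_inl V W a b c x y
    rw [e] at this
    exact sub_eq_zero.1 (congrArg Prod.fst this).symm
  · have := convCurvature_ofComponents_inl_mul_inr V W a b c x h
    rw [e] at this
    exact sub_eq_zero.1 (congrArg Prod.snd this).symm
  · have := convCurvature_ofComponents_inr_mul_inl V W a b c h x
    rw [e] at this
    exact (sub_eq_zero.1 (congrArg Prod.snd this).symm).symm
  · have := convCurvature_ofComponents_inl_mul_inl_mul_inl V W a b c x y z
    rw [e] at this
    exact sub_eq_zero.1 (congrArg Prod.snd this).symm
  · simp [convCurvature_ofComponents_inr, h₁]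
  · simp [convCurvature_ofComponents_inl_mul_inl, h₂]
  · simp [convCurvature_ofComponents_inl_mul_inr, h₃]
  · simp [convCurvature_ofComponents_inr_mul_inl, h₄]
  · simp [convCurvature_ofComponents_inl_mul_inl_mul_inl, h₅]

theorem twistedDiff_ofComponents_ofParam :
    twistedDiff V W (ofComponents a b c) (ofParam θ)
      = ofComponents (W.l₁ ∘ₗ θ) (θ ∘ₗ V.l₁)
        (V.l₂.compr₂ θ - W.l₂r.compl₁₂ a θ - W.l₂l.compl₁₂ θ a) := by
  refine convDeg_neg_one_ext (twistedDiff_mem (ofComponents_mem a b c) (ofParam_mem θ))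
    (ofComponents_mem _ _ _) (fun x => ?_) (fun h => ?_) fun x y => ?_
  · simp [twistedDiff, bracket₁_apply, bracket₂_apply, bracket₃_apply, conv₂_ι, conv₃_ι,
      V.codiff_ι, ofComponents_ι, ofParam_ι, TwoTermLeibniz.t₁_apply]
  · simp [twistedDiff, bracket₁_apply, bracket₂_apply, bracket₃_apply, conv₂_ι, conv₃_ι,
      V.codiff_ι, ofComponents_ι, ofParam_ι, TwoTermLeibniz.t₁_apply]
  · simp only [twistedDiff, one_div, Int.reduceNeg, smul_add, LinearMap.sub_apply, bracket₁_apply,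
      ofParam_ι_mul_ι, TwoTermLeibniz.t₁_apply, map_zero, zpow_ofNat, pow_zero,
      V.codiff_ι_mul_ι, koszul_inl, zpow_neg, pow_one, inv_neg, inv_one, neg_smul, one_smul,
      neg_mul, parity, LinearMap.prodMap_apply, LinearMap.id_coe, id_eq, LinearMap.neg_apply,
      neg_zero, TwoTermLeibniz.t₂_tmul, LinearMap.zero_apply, add_zero, map_add, map_neg, ofParam_ι,
      zero_add, LinearMap.smul_apply, bracket₂_apply, conv₂_ι_mul_ι, ofComponents_ι,
      mul_zero, Prod.mk_sub_mk, sub_self, sub_neg_eq_add, mul_neg, mul_one, Prod.smul_mk, smul_zero,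
      LinearMap.add_apply, bracket₃_apply, conv₃_ι_mul_ι, neg_neg, sub_zero, ofComponents_ι_mul_ι,
      LinearMap.compr₂_apply, LinearMap.compl₁₂_apply]
    module

end Components

/-! ### Infinity morphisms as Maurer-Cartan elements -/

section Morphisms

variable {K V₀ V₁ W₀ W₁ : Type*} [Field K]
  [AddCommGroup V₀] [Module K V₀] [AddCommGroup V₁] [Module K V₁]
  [AddCommGroup W₀] [Module K W₀] [AddCommGroup W₁] [Module K W₁]
  {V : TwoTermLeibniz K V₀ V₁} {W : TwoTermLeibniz K W₀ W₁}

theorem ofComponents_inj {a a' : V₀ →ₗ[K] W₀} {b b' : V₁ →ₗ[K] W₁} {c c' : V₀ →ₗ[K] V₀ →ₗ[K] W₁}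
    (h : ofComponents a b c = ofComponents a' b' c') : a = a' ∧ b = b' ∧ c = c' := by
  refine ⟨LinearMap.ext fun x => ?_, LinearMap.ext fun k => ?_, LinearMap.ext₂ fun x y => ?_⟩
  · simpa [ofComponents_ι] using congrArg Prod.fst (LinearMap.congr_fun h (ι K (x, 0)))
  · simpa [ofComponents_ι] using congrArg Prod.snd (LinearMap.congr_fun h (ι K (0, k)))
  · have := LinearMap.congr_fun h (ι K (x, (0 : V₁)) * ι K (y, (0 : V₁)))
    rw [ofComponents_ι_mul_ι, ofComponents_ι_mul_ι] at this
    exact congrArg Prod.snd this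

namespace InfMorphism

theorem ext_components {f g : InfMorphism V W} (h₁₀ : f.f₁₀ = g.f₁₀) (h₁₁ : f.f₁₁ = g.f₁₁)
    (h₂ : f.f₂ = g.f₂) : f = g := by
  cases f
  cases g
  congr

theorem toL_eq (f : InfMorphism V W) : f.toL = ofComponents f.f₁₀ f.f₁₁ f.f₂ := rfl

theorem toL_injective : Function.Injective (toL (V := V) (W := W)) := fun f g h =>
  have ⟨h₁₀, h₁₁, h₂⟩ := ofComponents_inj (f.toL_eq.symm.trans (h.trans g.toL_eq))
  ext_components h₁₀ h₁₁ h₂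

theorem toL_mem [Infinite K] (f : InfMorphism V W) :
    f.toL ∈ convDeg K V₀ V₁ W₀ W₁ (-1) :=
  ofComponents_mem _ _ _

section CharZero

variable [CharZero K]

theorem convCurvature_toL (f : InfMorphism V W) : convCurvature V W f.toL = 0 :=
  (convCurvature_ofComponents_eq_zero_iff V W _ _ _).2
    ⟨f.rel_a, f.rel_b, f.rel_c₁, f.rel_c₂, f.rel_d⟩

theorem exists_toL_eq {F : THom K V₀ V₁ W₀ W₁} (hF : F ∈ convDeg K V₀ V₁ W₀ W₁ (-1))
    (h : convCurvature V W F = 0) : ∃ f : InfMorphism V W, f.toL = F := by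
  obtain ⟨a, b, c, rfl⟩ := exists_eq_ofComponents hF
  obtain ⟨h₁, h₂, h₃, h₄, h₅⟩ := (convCurvature_ofComponents_eq_zero_iff V W a b c).1 h
  exact ⟨⟨a, b, c, h₁, h₂, h₃, h₄, h₅⟩, rfl⟩

end CharZero

/-- The target of the 2-term homotopy with source `f` and parameter `θ`. -/
def transport (f : InfMorphism V W) (θ : V₀ →ₗ[K] W₁) : InfMorphism V W where
  f₁₀ := f.f₁₀ + W.l₁ ∘ₗ θ
  f₁₁ := f.f₁₁ + θ ∘ₗ V.l₁
  f₂ := f.f₂ + V.l₂.compr₂ θ - W.l₂r.compl₁₂ f.f₁₀ θ - W.l₂l.compl₁₂ θ (f.f₁₀ + W.l₁ ∘ₗ θ)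
  rel_a h := by
    simp [f.rel_a]
  rel_b x y := by
    simp only [LinearMap.add_apply, LinearMap.coe_comp, Function.comp_apply, map_add,
      LinearMap.sub_apply, LinearMap.compr₂_apply, LinearMap.compl₁₂_apply, map_sub, W.rel_a₁,
      W.rel_a₂, ← f.rel_b]
    abel
  rel_c₁ x h := by
    simp only [LinearMap.add_apply, LinearMap.coe_comp, Function.comp_apply, map_add, f.rel_c₁,
      W.rel_b, V.rel_a₁, LinearMap.sub_apply, LinearMap.compr₂_apply, LinearMap.compl₁₂_apply,
      ← f.rel_a]
    abel
  rel_c₂ h x := by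
    simp only [LinearMap.add_apply, LinearMap.coe_comp, Function.comp_apply, map_add, f.rel_c₂,
      V.rel_a₂, LinearMap.sub_apply, LinearMap.compr₂_apply, LinearMap.compl₁₂_apply, ← f.rel_a,
      W.rel_b]
    abel
  rel_d x y z := by
    have h := f.rel_d x y z
    simp only [LinearMap.add_apply, LinearMap.coe_comp, Function.comp_apply, map_add, W.rel_d₁,
      W.rel_d₂, W.rel_d₃, ← W.rel_b, W.rel_a₂, LinearMap.sub_apply, LinearMap.compr₂_apply,
      LinearMap.compl₁₂_apply, map_sub, W.rel_a₁, V.rel_c, ← f.rel_b]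
    rw [W.rel_b (θ y) (W.l₂l (θ x) (f.f₁₀ z)), W.rel_a₂, ← sub_eq_zero, ← sub_eq_zero.2 h]
    abel

theorem transport_zero (f : InfMorphism V W) : f.transport 0 = f := by
  refine ext_components ?_ ?_ ?_ <;> ext <;> simp [transport]

/-- The 2-term homotopy with source `f` and parameter `θ`. -/
def homotopy (f : InfMorphism V W) (θ : V₀ →ₗ[K] W₁) : TwoTermHomotopy V W where
  f := f
  g := f.transport θ
  θ := θ
  rel_a x := by simp [transport]
  rel_b h := by simp [transport]
  rel_c x y := by
    simp only [transport, LinearMap.sub_apply, LinearMap.add_apply, LinearMap.compr₂_apply,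
      LinearMap.compl₁₂_apply, LinearMap.coe_comp, Function.comp_apply, map_add]
    abel

end InfMorphism

theorem TwoTermHomotopy.eq_homotopy (T : TwoTermHomotopy V W) : T = T.f.homotopy T.θ := by
  have h₁₀ : T.g.f₁₀ = T.f.f₁₀ + W.l₁ ∘ₗ T.θ :=
    LinearMap.ext fun x => sub_eq_iff_eq_add'.1 (T.rel_a x)
  have hg : T.g = T.f.transport T.θ := by
    refine InfMorphism.ext_components h₁₀
      (LinearMap.ext fun h => sub_eq_iff_eq_add'.1 (T.rel_b h)) (LinearMap.ext₂ fun x y => ?_)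
    rw [sub_eq_iff_eq_add'.1 (T.rel_c x y), h₁₀]
    simp only [LinearMap.add_apply, LinearMap.coe_comp, Function.comp_apply, map_add,
      InfMorphism.transport, LinearMap.sub_apply, LinearMap.compr₂_apply, LinearMap.compl₁₂_apply]
    abel
  obtain ⟨f, g, θ⟩ := T
  obtain rfl : g = f.transport θ := hg
  rfl

end Morphisms

/-! ### Values of vector-valued forms -/

section Values

variable {K M N P Q : Type*} [Field K] [AddCommGroup M] [Module K M] [AddCommGroup N] [Module K N]
  [AddCommGroup P] [Module K P] [AddCommGroup Q] [Module K Q]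

/-- The value `a(t)` of a form `a + b dt`. -/
def formVal (t : K) : Forms K →ₗ[K] K where
  toFun ω := ω.fst.eval t
  map_add' := by intros; simp
  map_smul' := by intros; simp

/-- The value `b(t)` of a form `a + b dt`. -/
def formCoeff (t : K) : Forms K →ₗ[K] K where
  toFun ω := ω.snd.eval t
  map_add' := by intros; simp
  map_smul' := by intros; simp

/-- The value `a(t)` of a form `a + b dt` with values in a vector space. -/
def valAt (t : K) : M ⊗[K] Forms K →ₗ[K] M :=
  (TensorProduct.rid K M).toLinearMap ∘ₗ (formVal t).lTensor M

/-- The value `b(t)` of a form `a + b dt` with values in a vector space. -/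
def coeffAt (t : K) : M ⊗[K] Forms K →ₗ[K] M :=
  (TensorProduct.rid K M).toLinearMap ∘ₗ (formCoeff t).lTensor M

/-- The derivative `a'(t)` of a form `a + b dt` with values in a vector space. -/
def derivAt (t : K) : M ⊗[K] Forms K →ₗ[K] M :=
  coeffAt t ∘ₗ formD.lTensor M

/-- The scalar form `φ(a) + φ(b) dt` given by a form `a + b dt` with values in `M` and a linear
functional `φ` on `M`. -/
def contract (φ : Module.Dual K M) : M ⊗[K] Forms K →ₗ[K] Forms K :=
  (TensorProduct.lid K (Forms K)).toLinearMap ∘ₗ φ.rTensor (Forms K)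

theorem valAt_tmul (t : K) (m : M) (ω : Forms K) : valAt t (m ⊗ₜ ω) = ω.fst.eval t • m := rfl

theorem coeffAt_tmul (t : K) (m : M) (ω : Forms K) : coeffAt t (m ⊗ₜ ω) = ω.snd.eval t • m := rfl

theorem derivAt_tmul (t : K) (m : M) (ω : Forms K) :
    derivAt t (m ⊗ₜ ω) = (Polynomial.derivative ω.fst).eval t • m := rfl

theorem contract_tmul (φ : Module.Dual K M) (m : M) (ω : Forms K) :
    contract φ (m ⊗ₜ ω) = φ m • ω := rfl

theorem eval_fst_contract (φ : Module.Dual K M) (t : K) (z : M ⊗[K] Forms K) :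
    (contract φ z).fst.eval t = φ (valAt t z) := by
  induction z using TensorProduct.induction_on with
  | zero => simp only [map_zero, TrivSqZeroExt.fst_zero, Polynomial.eval_zero]
  | add x y hx hy =>
    rw [map_add, map_add, map_add, TrivSqZeroExt.fst_add, Polynomial.eval_add, hx, hy]
  | tmul m ω => simp [contract_tmul, valAt_tmul, mul_comm]

theorem eval_snd_contract (φ : Module.Dual K M) (t : K) (z : M ⊗[K] Forms K) :
    (contract φ z).snd.eval t = φ (coeffAt t z) := by
  induction z using TensorProduct.induction_on with
  | zero => simp only [map_zero, TrivSqZeroExt.snd_zero, Polynomial.eval_zero]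
  | add x y hx hy =>
    rw [map_add, map_add, map_add, TrivSqZeroExt.snd_add, Polynomial.eval_add, hx, hy]
  | tmul m ω => simp [contract_tmul, coeffAt_tmul, mul_comm]

theorem eval_derivative_fst_contract (φ : Module.Dual K M) (t : K) (z : M ⊗[K] Forms K) :
    (Polynomial.derivative (contract φ z).fst).eval t = φ (derivAt t z) := by
  induction z using TensorProduct.induction_on with
  | zero => simp only [map_zero, TrivSqZeroExt.fst_zero, Polynomial.eval_zero]
  | add x y hx hy =>
    rw [map_add, map_add, map_add, TrivSqZeroExt.fst_add, map_add, Polynomial.eval_add, hx, hy]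
  | tmul m ω => simp [contract_tmul, derivAt_tmul, mul_comm]

theorem eq_zero_of_contract_eq_zero {z : M ⊗[K] Forms K} (h : ∀ φ, contract φ z = 0) : z = 0 := by
  classical
  let b := Module.Basis.ofVectorSpace K M
  have coord (n) (w : M ⊗[K] Forms K) :
      TensorProduct.equivFinsuppOfBasisLeft b w n = contract (b.coord n) w := by
    induction w using TensorProduct.induction_on with
    | zero => simp only [map_zero, Finsupp.zero_apply]
    | add x y hx hy => rw [map_add, map_add, Finsupp.add_apply, hx, hy]
    | tmul m ω => simp [contract_tmul]
  refine (TensorProduct.equivFinsuppOfBasisLeft b).map_eq_zero_iff.1 (Finsupp.ext fun n => ?_)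
  rw [coord, h, Finsupp.zero_apply]

theorem eq_zero_of_valAt_of_coeffAt [Infinite K] {z : M ⊗[K] Forms K} (h₀ : ∀ t, valAt t z = 0)
    (h₁ : ∀ t, coeffAt t z = 0) : z = 0 :=
  eq_zero_of_contract_eq_zero fun φ => TrivSqZeroExt.ext
    (Polynomial.funext fun t => by
      rw [eval_fst_contract, h₀, map_zero, TrivSqZeroExt.fst_zero, Polynomial.eval_zero])
    (Polynomial.funext fun t => by
      rw [eval_snd_contract, h₁, map_zero, TrivSqZeroExt.snd_zero, Polynomial.eval_zero])

theorem valAt_eq_of_derivAt_eq_zero [CharZero K] {z : M ⊗[K] Forms K}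
    (h : ∀ t, derivAt t z = 0) (s t : K) : valAt s z = valAt t z := by
  rw [← sub_eq_zero, ← Module.forall_dual_apply_eq_zero_iff K]
  intro φ
  have h' : Polynomial.derivative (contract φ z).fst = 0 := Polynomial.funext fun r => by
    rw [eval_derivative_fst_contract, h, map_zero, Polynomial.eval_zero]
  rw [map_sub, ← eval_fst_contract, ← eval_fst_contract,
    Polynomial.eq_C_of_derivative_eq_zero h', Polynomial.eval_C, Polynomial.eval_C, sub_self]

theorem valAt_map_id (L : M →ₗ[K] N) (t : K) (z : M ⊗[K] Forms K) :
    valAt t (TensorProduct.map L LinearMap.id z) = L (valAt t z) := by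
  suffices h : valAt t ∘ₗ TensorProduct.map L LinearMap.id = L ∘ₗ valAt t from
    LinearMap.congr_fun h z
  exact TensorProduct.ext' fun m ω => by simp [valAt_tmul]

theorem coeffAt_map_id (L : M →ₗ[K] N) (t : K) (z : M ⊗[K] Forms K) :
    coeffAt t (TensorProduct.map L LinearMap.id z) = L (coeffAt t z) := by
  suffices h : coeffAt t ∘ₗ TensorProduct.map L LinearMap.id = L ∘ₗ coeffAt t from
    LinearMap.congr_fun h z
  exact TensorProduct.ext' fun m ω => by simp [coeffAt_tmul]

theorem derivAt_map_id (L : M →ₗ[K] N) (t : K) (z : M ⊗[K] Forms K) :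
    derivAt t (TensorProduct.map L LinearMap.id z) = L (derivAt t z) := by
  suffices h : derivAt t ∘ₗ TensorProduct.map L LinearMap.id = L ∘ₗ derivAt t from
    LinearMap.congr_fun h z
  exact TensorProduct.ext' fun m ω => by simp [derivAt_tmul]

theorem valAt_map_id_formD (t : K) (z : M ⊗[K] Forms K) :
    valAt t (TensorProduct.map LinearMap.id formD z) = 0 := by
  suffices h : valAt t ∘ₗ TensorProduct.map LinearMap.id formD = (0 : M ⊗[K] Forms K →ₗ[K] M) from
    LinearMap.congr_fun h z
  exact TensorProduct.ext' fun m ω => by simp [valAt_tmul, formD]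

theorem coeffAt_map_id_formD (t : K) (z : M ⊗[K] Forms K) :
    coeffAt t (TensorProduct.map LinearMap.id formD z) = derivAt t z := rfl

section Products

variable (B : M →ₗ[K] N →ₗ[K] P) (T : M →ₗ[K] N →ₗ[K] P →ₗ[K] Q) (t : K)
  (x : M ⊗[K] Forms K) (y : N ⊗[K] Forms K) (z : P ⊗[K] Forms K)

theorem valAt_map₂_mul : valAt t (TensorProduct.map₂ B (LinearMap.mul K (Forms K)) x y)
    = B (valAt t x) (valAt t y) := by
  induction x using TensorProduct.induction_on with
  | zero => simp only [map_zero, LinearMap.zero_apply]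
  | add x x' hx hx' => simp only [map_add, LinearMap.add_apply, hx, hx']
  | tmul m ω =>
    induction y using TensorProduct.induction_on with
    | zero => simp only [map_zero]
    | add y y' hy hy' => simp only [map_add, hy, hy']
    | tmul n η => simp [valAt_tmul, smul_smul, mul_comm]

theorem coeffAt_map₂_mul : coeffAt t (TensorProduct.map₂ B (LinearMap.mul K (Forms K)) x y)
    = B (valAt t x) (coeffAt t y) + B (coeffAt t x) (valAt t y) := by
  induction x using TensorProduct.induction_on with
  | zero => simp only [map_zero, LinearMap.zero_apply, add_zero]
  | add x x' hx hx' => simp only [map_add, LinearMap.add_apply, hx, hx', add_add_add_comm]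
  | tmul m ω =>
    induction y using TensorProduct.induction_on with
    | zero => simp only [map_zero, add_zero]
    | add y y' hy hy' => simp only [map_add, hy, hy', add_add_add_comm]
    | tmul n η => simp [valAt_tmul, coeffAt_tmul, smul_smul, add_smul, mul_comm]

theorem derivAt_map₂_mul : derivAt t (TensorProduct.map₂ B (LinearMap.mul K (Forms K)) x y)
    = B (derivAt t x) (valAt t y) + B (valAt t x) (derivAt t y) := by
  induction x using TensorProduct.induction_on with
  | zero => simp only [map_zero, LinearMap.zero_apply, add_zero]
  | add x x' hx hx' => simp only [map_add, LinearMap.add_apply, hx, hx', add_add_add_comm]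
  | tmul m ω =>
    induction y using TensorProduct.induction_on with
    | zero => simp only [map_zero, add_zero]
    | add y y' hy hy' => simp only [map_add, hy, hy', add_add_add_comm]
    | tmul n η => simp [valAt_tmul, derivAt_tmul, smul_smul, add_smul, mul_comm]

/-- The product `(f ⊗ ω, g ⊗ η, h ⊗ ζ) ↦ T(f, g, h) ⊗ ωηζ` of vector-valued forms given by a
trilinear map `T`. -/
def mulForms₃ : Q ⊗[K] Forms K :=
  TensorProduct.homTensorHomMap (RingHom.id K) _ _ _ _
    (TensorProduct.map₂ T ((LinearMap.mul K (Forms K)).compr₂ (LinearMap.mul K (Forms K))) x y) z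

theorem valAt_mulForms₃ :
    valAt t (mulForms₃ T x y z) = T (valAt t x) (valAt t y) (valAt t z) := by
  unfold mulForms₃
  induction x using TensorProduct.induction_on with
  | zero => simp only [map_zero, LinearMap.zero_apply]
  | add x x' hx hx' => simp only [map_add, LinearMap.add_apply, hx, hx']
  | tmul m ω =>
    induction y using TensorProduct.induction_on with
    | zero => simp only [map_zero, LinearMap.zero_apply]
    | add y y' hy hy' => simp only [map_add, LinearMap.add_apply, hy, hy']
    | tmul n η =>
      induction z using TensorProduct.induction_on with
      | zero => simp only [map_zero]
      | add z z' hz hz' => simp only [map_add, hz, hz']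
      | tmul p ζ => simp [valAt_tmul, smul_smul, mul_comm, mul_assoc, mul_left_comm]

theorem coeffAt_mulForms₃ : coeffAt t (mulForms₃ T x y z)
    = T (valAt t x) (valAt t y) (coeffAt t z) + T (valAt t x) (coeffAt t y) (valAt t z)
      + T (coeffAt t x) (valAt t y) (valAt t z) := by
  unfold mulForms₃
  induction x using TensorProduct.induction_on with
  | zero => simp only [map_zero, LinearMap.zero_apply, add_zero]
  | add x x' hx hx' =>
    simp only [map_add, LinearMap.add_apply, hx, hx']
    abel
  | tmul m ω =>
    induction y using TensorProduct.induction_on with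
    | zero => simp only [map_zero, LinearMap.zero_apply, add_zero]
    | add y y' hy hy' =>
      simp only [map_add, LinearMap.add_apply, hy, hy']
      abel
    | tmul n η =>
      induction z using TensorProduct.induction_on with
      | zero => simp only [map_zero, add_zero]
      | add z z' hz hz' =>
        simp only [map_add, hz, hz']
        abel
      | tmul p ζ =>
        simp only [TensorProduct.map₂_apply_tmul, TensorProduct.map_tmul, LinearMap.compr₂_apply,
          LinearMap.mul_apply_apply, TensorProduct.homTensorHomMap_apply, coeffAt_tmul,
          TrivSqZeroExt.snd_mul, TrivSqZeroExt.fst_mul, smul_eq_mul, MulOpposite.smul_eq_mul_unop,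
          MulOpposite.unop_op, smul_add, Polynomial.eval_add, Polynomial.eval_mul, valAt_tmul,
          map_smul, LinearMap.smul_apply, smul_smul]
        module

end Products

end Values

/-! ### Polynomial curves -/

section PolyCurves

variable {K M N P : Type*} [Field K] [AddCommGroup M] [Module K M] [AddCommGroup N] [Module K N]
  [AddCommGroup P] [Module K P]

/-- `u` is a polynomial curve in the vector space `M`, with derivative `u'`. Polynomials with
coefficients in `M` are encoded as `M`-valued forms. -/
def HasPolyDeriv (u u' : K → M) : Prop :=
  ∃ z : M ⊗[K] Forms K, (∀ t, valAt t z = u t) ∧ ∀ t, derivAt t z = u' t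

theorem hasPolyDeriv_valAt (z : M ⊗[K] Forms K) :
    HasPolyDeriv (fun t => valAt t z) fun t => derivAt t z :=
  ⟨z, fun _ => rfl, fun _ => rfl⟩

theorem hasPolyDeriv_const (m : M) : HasPolyDeriv (fun _ : K => m) fun _ => 0 :=
  ⟨m ⊗ₜ 1, by simp [valAt_tmul], by simp [derivAt_tmul]⟩

namespace HasPolyDeriv

variable {u u' v v' : K → M}

theorem sub (hu : HasPolyDeriv u u') (hv : HasPolyDeriv v v') :
    HasPolyDeriv (fun t => u t - v t) fun t => u' t - v' t :=
  have ⟨y, hy, hy'⟩ := hu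
  have ⟨z, hz, hz'⟩ := hv
  ⟨y - z, fun t => by rw [map_sub, hy, hz], fun t => by rw [map_sub, hy', hz']⟩

theorem map (L : M →ₗ[K] N) (hu : HasPolyDeriv u u') :
    HasPolyDeriv (fun t => L (u t)) fun t => L (u' t) :=
  have ⟨z, hz, hz'⟩ := hu
  ⟨TensorProduct.map L LinearMap.id z, fun t => by rw [valAt_map_id, hz],
    fun t => by rw [derivAt_map_id, hz']⟩

theorem map₂ (B : M →ₗ[K] N →ₗ[K] P) {w w' : K → N} (hu : HasPolyDeriv u u')
    (hw : HasPolyDeriv w w') :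
    HasPolyDeriv (fun t => B (u t) (w t)) fun t => B (u' t) (w t) + B (u t) (w' t) :=
  have ⟨y, hy, hy'⟩ := hu
  have ⟨z, hz, hz'⟩ := hw
  ⟨TensorProduct.map₂ B (LinearMap.mul K (Forms K)) y z,
    fun t => by rw [valAt_map₂_mul, hy, hz],
    fun t => by rw [derivAt_map₂_mul, hy, hy', hz, hz']⟩

theorem sub_eq_sub [CharZero K] (hu : HasPolyDeriv u u') (hv : HasPolyDeriv v u') (s t : K) :
    u s - u t = v s - v t := by
  obtain ⟨z, hz, hz'⟩ := hu.sub hv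
  have h := valAt_eq_of_derivAt_eq_zero (fun t => (hz' t).trans (sub_self _)) s t
  rw [hz, hz] at h
  exact sub_eq_sub_iff_sub_eq_sub.1 h

end HasPolyDeriv

end PolyCurves

/-! ### Forms with values in the convolution algebra -/

section LForms

variable {K V₀ V₁ W₀ W₁ : Type*} [Field K]
  [AddCommGroup V₀] [Module K V₀] [AddCommGroup V₁] [Module K V₁]
  [AddCommGroup W₀] [Module K W₀] [AddCommGroup W₁] [Module K W₁]

theorem formPr_zero (ω : Forms K) : formPr 0 ω = TrivSqZeroExt.inl ω.fst := by simp [formPr]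

theorem formPr_one (ω : Forms K) : formPr 1 ω = TrivSqZeroExt.inr ω.snd := by simp [formPr]

theorem pr_tmul (j : Fin 2) (f : THom K V₀ V₁ W₀ W₁) (ω : Forms K) :
    pr j (f ⊗ₜ[K] ω) = f ⊗ₜ[K] formPr j ω := rfl

section Brackets

variable (V : TwoTermLeibniz K V₀ V₁) (W : TwoTermLeibniz K W₀ W₁) (t : K) (n n₁ n₂ n₃ : ℤ)
  (F F₁ F₂ F₃ : LForms K V₀ V₁ W₀ W₁)

theorem valAt_pr_zero : valAt t (pr 0 F) = valAt t F := by
  induction F using TensorProduct.induction_on with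
  | zero => simp only [map_zero]
  | add x y hx hy => simp only [map_add, hx, hy]
  | tmul f ω => simp [pr_tmul, formPr_zero, valAt_tmul]

theorem valAt_pr_one : valAt t (pr 1 F) = 0 := by
  induction F using TensorProduct.induction_on with
  | zero => simp only [map_zero]
  | add x y hx hy => simp only [map_add, hx, hy, add_zero]
  | tmul f ω => simp [pr_tmul, formPr_one, valAt_tmul]

theorem coeffAt_pr_zero : coeffAt t (pr 0 F) = 0 := by
  induction F using TensorProduct.induction_on with
  | zero => simp only [map_zero]
  | add x y hx hy => simp only [map_add, hx, hy, add_zero]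
  | tmul f ω => simp [pr_tmul, formPr_zero, coeffAt_tmul]

theorem coeffAt_pr_one : coeffAt t (pr 1 F) = coeffAt t F := by
  induction F using TensorProduct.induction_on with
  | zero => simp only [map_zero]
  | add x y hx hy => simp only [map_add, hx, hy]
  | tmul f ω => simp [pr_tmul, formPr_one, coeffAt_tmul]

theorem derivAt_pr_zero : derivAt t (pr 0 F) = derivAt t F := by
  induction F using TensorProduct.induction_on with
  | zero => simp only [map_zero]
  | add x y hx hy => simp only [map_add, hx, hy]
  | tmul f ω => simp [pr_tmul, formPr_zero, derivAt_tmul]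

theorem derivAt_pr_one : derivAt t (pr 1 F) = 0 := by
  induction F using TensorProduct.induction_on with
  | zero => simp only [map_zero]
  | add x y hx hy => simp only [map_add, hx, hy, add_zero]
  | tmul f ω => simp [pr_tmul, formPr_one, derivAt_tmul]

theorem valAt_extBracket₁ : valAt t (extBracket₁ V W n F) = bracket₁ V W n (valAt t F) := by
  simp [extBracket₁, valAt_map_id, valAt_map_id_formD, valAt_pr_zero, valAt_pr_one]

theorem coeffAt_extBracket₁ : coeffAt t (extBracket₁ V W n F)
    = bracket₁ V W (n + 1) (coeffAt t F) + (-1 : K) ^ n • derivAt t F := by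
  simp only [extBracket₁, Fin.sum_univ_two, Fin.isValue, Fin.coe_ofNat_eq_mod, Nat.zero_mod,
    CharP.cast_eq_zero, add_zero, Nat.mod_succ, Nat.cast_one, map_add, coeffAt_map_id,
    coeffAt_pr_zero, map_zero, map_smul, coeffAt_map_id_formD, derivAt_pr_zero, zero_add,
    coeffAt_pr_one, derivAt_pr_one, smul_zero]
  rw [add_comm]

theorem valAt_extBracket₂ : valAt t (extBracket₂ W n₁ n₂ F₁ F₂)
    = bracket₂ W n₁ n₂ (valAt t F₁) (valAt t F₂) := by
  simp [extBracket₂, valAt_map₂_mul, valAt_pr_zero, valAt_pr_one]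

theorem coeffAt_extBracket₂ : coeffAt t (extBracket₂ W n₁ n₂ F₁ F₂)
    = bracket₂ W n₁ (n₂ + 1) (valAt t F₁) (coeffAt t F₂)
      + (-1 : K) ^ n₂ • bracket₂ W (n₁ + 1) n₂ (coeffAt t F₁) (valAt t F₂) := by
  simp [extBracket₂, coeffAt_map₂_mul, valAt_pr_zero, valAt_pr_one, coeffAt_pr_zero,
    coeffAt_pr_one]

theorem extBracket₃_eq : extBracket₃ W n₁ n₂ n₃ F₁ F₂ F₃
    = ∑ j₁ : Fin 2, ∑ j₂ : Fin 2, ∑ j₃ : Fin 2,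
      ((-1 : K) ^ ((j₁.val : ℤ) * ((n₂ + j₂.val) + (n₃ + j₃.val)) + j₂.val * (n₃ + j₃.val))) •
        mulForms₃ (bracket₃ W (n₁ + j₁.val) (n₂ + j₂.val) (n₃ + j₃.val))
          (pr j₁ F₁) (pr j₂ F₂) (pr j₃ F₃) := rfl

theorem valAt_extBracket₃ : valAt t (extBracket₃ W n₁ n₂ n₃ F₁ F₂ F₃)
    = bracket₃ W n₁ n₂ n₃ (valAt t F₁) (valAt t F₂) (valAt t F₃) := by
  simp [extBracket₃_eq, valAt_mulForms₃, valAt_pr_zero, valAt_pr_one]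

theorem coeffAt_extBracket₃ : coeffAt t (extBracket₃ W n₁ n₂ n₃ F₁ F₂ F₃)
    = bracket₃ W n₁ n₂ (n₃ + 1) (valAt t F₁) (valAt t F₂) (coeffAt t F₃)
      + (-1 : K) ^ n₃ • bracket₃ W n₁ (n₂ + 1) n₃ (valAt t F₁) (coeffAt t F₂) (valAt t F₃)
      + (-1 : K) ^ (n₂ + n₃) •
        bracket₃ W (n₁ + 1) n₂ n₃ (coeffAt t F₁) (valAt t F₂) (valAt t F₃) := by
  simp [extBracket₃_eq, coeffAt_mulForms₃, valAt_pr_zero, valAt_pr_one, coeffAt_pr_zero,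
    coeffAt_pr_one]

theorem valAt_curvature : valAt t (curvature V W F) = convCurvature V W (valAt t F) := by
  simp only [curvature, map_sub, map_smul, valAt_extBracket₁, valAt_extBracket₂, valAt_extBracket₃,
    convCurvature]

theorem coeffAt_curvature :
    coeffAt t (curvature V W F) = twistedDiff V W (valAt t F) (coeffAt t F) - derivAt t F := by
  simp only [curvature, map_sub, map_smul, coeffAt_extBracket₁, coeffAt_extBracket₂,
    coeffAt_extBracket₃, twistedDiff, neg_add_cancel, zpow_neg_one, inv_neg_one,
    show (-1 : K) ^ (-1 + -1 : ℤ) = 1 by norm_num]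
  module

end Brackets

section Degree

variable {n : ℤ}

theorem totDeg_le {S : Submodule K (LForms K V₀ V₁ W₀ W₁)}
    (val : ∀ f ∈ convDeg K V₀ V₁ W₀ W₁ n, ∀ q : K[X], f ⊗ₜ TrivSqZeroExt.inl q ∈ S)
    (coeff : ∀ f ∈ convDeg K V₀ V₁ W₀ W₁ (n + 1), ∀ q : K[X], f ⊗ₜ TrivSqZeroExt.inr q ∈ S) :
    totDeg K V₀ V₁ W₀ W₁ n ≤ S := by
  refine iSup_le fun j => Submodule.map₂_le.2 ?_
  rintro f hf _ ⟨ω, rfl⟩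
  fin_cases j
  · simpa [formPr_zero] using val f (by simpa using hf) ω.fst
  · simpa [formPr_one] using coeff f (by simpa using hf) ω.snd

theorem valAt_mem {α : LForms K V₀ V₁ W₀ W₁} (hα : α ∈ totDeg K V₀ V₁ W₀ W₁ n) (t : K) :
    valAt t α ∈ convDeg K V₀ V₁ W₀ W₁ n := by
  suffices h : totDeg K V₀ V₁ W₀ W₁ n ≤ (convDeg K V₀ V₁ W₀ W₁ n).comap (valAt t) from h hα
  refine totDeg_le (fun f hf q => ?_) (fun f _ q => ?_)
  · exact Submodule.smul_mem _ _ hf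
  · simp [valAt_tmul]

theorem coeffAt_mem {α : LForms K V₀ V₁ W₀ W₁} (hα : α ∈ totDeg K V₀ V₁ W₀ W₁ n) (t : K) :
    coeffAt t α ∈ convDeg K V₀ V₁ W₀ W₁ (n + 1) := by
  suffices h : totDeg K V₀ V₁ W₀ W₁ n ≤ (convDeg K V₀ V₁ W₀ W₁ (n + 1)).comap (coeffAt t) from
    h hα
  refine totDeg_le (fun f _ q => ?_) (fun f hf q => ?_)
  · simp [coeffAt_tmul]
  · exact Submodule.smul_mem _ _ hf

theorem tmul_inl_mem_totDeg {f : THom K V₀ V₁ W₀ W₁} (hf : f ∈ convDeg K V₀ V₁ W₀ W₁ n)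
    (q : K[X]) : f ⊗ₜ[K] TrivSqZeroExt.inl q ∈ totDeg K V₀ V₁ W₀ W₁ n :=
  Submodule.mem_iSup_of_mem 0 (Submodule.apply_mem_map₂ _ (by simpa using hf)
    ⟨TrivSqZeroExt.inl q, formPr_zero _⟩)

theorem tmul_inr_mem_totDeg {f : THom K V₀ V₁ W₀ W₁} (hf : f ∈ convDeg K V₀ V₁ W₀ W₁ (n + 1))
    (q : K[X]) : f ⊗ₜ[K] TrivSqZeroExt.inr q ∈ totDeg K V₀ V₁ W₀ W₁ n :=
  Submodule.mem_iSup_of_mem 1 (Submodule.apply_mem_map₂ _ (by simpa using hf)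
    ⟨TrivSqZeroExt.inr q, formPr_one _⟩)

end Degree

end LForms

/-! ### From infinity homotopies to 2-term homotopies -/

section Integration

variable {K V₀ V₁ W₀ W₁ : Type*} [Field K]
  [AddCommGroup V₀] [Module K V₀] [AddCommGroup V₁] [Module K V₁]
  [AddCommGroup W₀] [Module K W₀] [AddCommGroup W₁] [Module K W₁]
  {V : TwoTermLeibniz K V₀ V₁} {W : TwoTermLeibniz K W₀ W₁}

/-- The polynomial family `F` of infinity morphisms is a solution of the gauge flow equation
`F'(t) = d_{F(t)} β(t)`, with `d_F` the twisted differential. -/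
structure IsGaugeFlow (F : K → InfMorphism V W) (β : K → V₀ →ₗ[K] W₁) : Prop where
  f₁₀ (x) : HasPolyDeriv (fun t => (F t).f₁₀ x) fun t => W.l₁ (β t x)
  f₁₁ (h) : HasPolyDeriv (fun t => (F t).f₁₁ h) fun t => β t (V.l₁ h)
  f₂ (x y) : HasPolyDeriv (fun t => (F t).f₂ x y) fun t =>
    β t (V.l₂ x y) - W.l₂r ((F t).f₁₀ x) (β t y) - W.l₂l (β t x) ((F t).f₁₀ y)

namespace IsGaugeFlow

variable {F : K → InfMorphism V W} {β : K → V₀ →ₗ[K] W₁}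

theorem of_hasPolyDeriv [CharZero K]
    (hF : HasPolyDeriv (fun t => (F t).toL) fun t => twistedDiff V W (F t).toL (ofParam (β t))) :
    IsGaugeFlow F β := by
  simp only [InfMorphism.toL_eq, twistedDiff_ofComponents_ofParam] at hF
  refine ⟨fun x => ?_, fun h => ?_, fun x y => ?_⟩
  · simpa [ofComponents_ι] using
      hF.map (LinearMap.fst K W₀ W₁ ∘ₗ LinearMap.applyₗ (ι K (x, (0 : V₁))))
  · simpa [ofComponents_ι] using
      hF.map (LinearMap.snd K W₀ W₁ ∘ₗ LinearMap.applyₗ (ι K ((0 : V₀), h)))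
  · simpa [ofComponents_ι_mul_ι] using
      hF.map (LinearMap.snd K W₀ W₁ ∘ₗ LinearMap.applyₗ (ι K (x, (0 : V₁)) * ι K (y, (0 : V₁))))

variable [CharZero K] {p : K → V₀ →ₗ[K] W₁}

theorem f₁₀_eq (hF : IsGaugeFlow F β) (hp : HasPolyDeriv p β) (s t : K) (x : V₀) :
    (F t).f₁₀ x = (F s).f₁₀ x + W.l₁ ((p t - p s) x) := by
  have h := (hF.f₁₀ x).sub_eq_sub (hp.map (W.l₁ ∘ₗ LinearMap.applyₗ x)) t s
  rw [sub_eq_iff_eq_add'.1 h]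
  simp

theorem f₁₁_eq (hF : IsGaugeFlow F β) (hp : HasPolyDeriv p β) (s t : K) (h : V₁) :
    (F t).f₁₁ h = (F s).f₁₁ h + (p t - p s) (V.l₁ h) := by
  have e := (hF.f₁₁ h).sub_eq_sub (hp.map (LinearMap.applyₗ (V.l₁ h))) t s
  rw [sub_eq_iff_eq_add'.1 e]
  simp

/-- By `f₁₀_eq`, the terms `l₂(f₁₀ x, β y)` and `l₂(β x, f₁₀ y)` of the derivative of `f₂ x y` add
up to a constant part and to the derivative of `l₂(q x, l₁ (q y))`, where `q t = p t - p s`. -/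
theorem f₂_eq (hF : IsGaugeFlow F β) (hp : HasPolyDeriv p β) (s t : K) (x y : V₀) :
    (F t).f₂ x y = (F s).f₂ x y + (p t - p s) (V.l₂ x y) - W.l₂r ((F s).f₁₀ x) ((p t - p s) y)
      - W.l₂l ((p t - p s) x) ((F s).f₁₀ y + W.l₁ ((p t - p s) y)) := by
  have hq (z : V₀) : HasPolyDeriv (fun r => (p r - p s) z) fun r => β r z := by
    simpa using (hp.sub (hasPolyDeriv_const (p s))).map (LinearMap.applyₗ z)
  have hc := (((hq (V.l₂ x y)).sub ((hq y).map (W.l₂r ((F s).f₁₀ x)))).sub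
    ((hq x).map (W.l₂l.flip ((F s).f₁₀ y)))).sub ((hq x).map₂ W.l₂l ((hq y).map W.l₁))
  have hβ (r : K) : β r (V.l₂ x y) - W.l₂r ((F r).f₁₀ x) (β r y) - W.l₂l (β r x) ((F r).f₁₀ y)
      = β r (V.l₂ x y) - W.l₂r ((F s).f₁₀ x) (β r y) - W.l₂l.flip ((F s).f₁₀ y) (β r x)
        - (W.l₂l (β r x) (W.l₁ ((p r - p s) y)) + W.l₂l ((p r - p s) x) (W.l₁ (β r y))) := by
    rw [hF.f₁₀_eq hp s r x, hF.f₁₀_eq hp s r y, map_add, map_add, LinearMap.add_apply, W.rel_b,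
      LinearMap.flip_apply]
    abel
  have hf := hF.f₂ x y
  simp only [hβ] at hf
  rw [sub_eq_iff_eq_add'.1 (hf.sub_eq_sub hc t s), sub_self]
  simp only [LinearMap.zero_apply, LinearMap.flip_apply, map_zero, map_add, sub_zero]
  abel

theorem eq_transport (hF : IsGaugeFlow F β) (hp : HasPolyDeriv p β) (s t : K) :
    F t = (F s).transport (p t - p s) :=
  InfMorphism.ext_components (LinearMap.ext (hF.f₁₀_eq hp s t)) (LinearMap.ext (hF.f₁₁_eq hp s t))
    (LinearMap.ext₂ (hF.f₂_eq hp s t))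

end IsGaugeFlow

section Operators

theorem derivative_primitive [CharZero K] (q : K[X]) :
    Polynomial.derivative (primitive q) = q := by
  induction q using Polynomial.induction_on' with
  | add p q hp hq => rw [map_add, map_add, hp, hq]
  | monomial n a =>
    have h : (n + 1 : K) ≠ 0 := n.cast_add_one_ne_zero
    simp [primitive, Polynomial.lsum_apply, Polynomial.sum_monomial_index,
      Polynomial.smul_monomial, mul_right_comm _ a, h]

theorem primitive_one : primitive (1 : K[X]) = Polynomial.X := by
  rw [← Polynomial.monomial_zero_one, primitive, Polynomial.lsum_apply,
    Polynomial.sum_monomial_index _ _ (by simp)]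
  simp [Polynomial.monomial_one_one_eq_X]

theorem evalAt_zero : (evalAt 0 : LForms K V₀ V₁ W₀ W₁ →ₗ[K] THom K V₀ V₁ W₀ W₁) = valAt 0 := by
  change valAt ((0 : ℕ) : K) = valAt 0
  rw [Nat.cast_zero]

theorem evalAt_one : (evalAt 1 : LForms K V₀ V₁ W₀ W₁ →ₗ[K] THom K V₀ V₁ W₀ W₁) = valAt 1 := by
  change valAt ((1 : ℕ) : K) = valAt 1
  rw [Nat.cast_one]

theorem homotopyOp_tmul (i : Fin 2) (n : ℤ) (f : THom K V₀ V₁ W₀ W₁) (ω : Forms K) :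
    homotopyOp i n (f ⊗ₜ[K] ω) = (-1 : K) ^ (n + 1) • f ⊗ₜ[K] formH i ω := by
  have h₀ : formH i (formPr 0 ω) = 0 := by simp [formH, formPr_zero]
  have h₁ : formH i (formPr 1 ω) = formH i ω := by simp [formH, formPr_one]
  simp [homotopyOp, pr_tmul, h₀, h₁]

theorem derivAt_homotopyOp [CharZero K] (i : Fin 2) (n : ℤ) (α : LForms K V₀ V₁ W₀ W₁) (t : K) :
    derivAt t (homotopyOp i n α) = (-1 : K) ^ (n + 1) • coeffAt t α := by
  induction α using TensorProduct.induction_on with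
  | zero => simp only [map_zero, smul_zero]
  | add x y hx hy => rw [map_add, map_add, map_add, hx, hy, smul_add]
  | tmul f ω =>
    simp [homotopyOp_tmul, derivAt_tmul, coeffAt_tmul, formH, derivative_primitive]

theorem homotopyParam_eq (i : Fin 2) (α : LForms K V₀ V₁ W₀ W₁) :
    homotopyParam i α = param (valAt 1 (homotopyOp i (-1) α))
      - param (valAt 0 (homotopyOp i (-1) α)) := by
  rw [← map_sub, ← evalAt_zero, ← evalAt_one]
  rfl

theorem hasPolyDeriv_param_homotopyOp [CharZero K] (i : Fin 2) (α : LForms K V₀ V₁ W₀ W₁) :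
    HasPolyDeriv (fun t => param (valAt t (homotopyOp i (-1) α)))
      fun t => param (coeffAt t α) := by
  simpa only [derivAt_homotopyOp, neg_add_cancel, zpow_zero, one_smul] using
    (hasPolyDeriv_valAt (homotopyOp i (-1) α)).map param

end Operators

namespace InfHomotopy

variable (α : InfHomotopy V W)

theorem derivAt_eq_twistedDiff (t : K) :
    derivAt t α.α = twistedDiff V W (valAt t α.α) (coeffAt t α.α) := by
  have h := coeffAt_curvature V W t α.α
  rwa [α.maurerCartan, map_zero, eq_comm, sub_eq_zero, eq_comm] at h

variable [CharZero K]

theorem exists_toL_eq_valAt (t : K) : ∃ f : InfMorphism V W, f.toL = valAt t α.α :=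
  InfMorphism.exists_toL_eq (valAt_mem α.degree t)
    (by rw [← valAt_curvature, α.maurerCartan, map_zero])

/-- The infinity morphism given by the value at `t` of an infinity homotopy. -/
def morphismAt (t : K) : InfMorphism V W :=
  (α.exists_toL_eq_valAt t).choose

theorem toL_morphismAt (t : K) : (α.morphismAt t).toL = valAt t α.α :=
  (α.exists_toL_eq_valAt t).choose_spec

theorem isGaugeFlow_morphismAt :
    IsGaugeFlow α.morphismAt fun t => param (coeffAt t α.α) := by
  refine .of_hasPolyDeriv ?_
  have h (t : K) : ofParam (param (coeffAt t α.α)) = coeffAt t α.α :=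
    ofParam_param (by simpa using coeffAt_mem α.degree t)
  simpa only [toL_morphismAt, h, derivAt_eq_twistedDiff] using hasPolyDeriv_valAt α.α

theorem morphismAt_one (i : Fin 2) :
    α.morphismAt 1 = (α.morphismAt 0).transport (homotopyParam i α.α) := by
  rw [homotopyParam_eq]
  exact α.isGaugeFlow_morphismAt.eq_transport (hasPolyDeriv_param_homotopyOp i α.α) 0 1

theorem mem_infHomotopies_iff {f g : InfMorphism V W} :
    α ∈ infHomotopies f g ↔ α.morphismAt 0 = f ∧ α.morphismAt 1 = g := by
  rw [← InfMorphism.toL_injective.eq_iff, ← InfMorphism.toL_injective.eq_iff, toL_morphismAt,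
    toL_morphismAt, ← evalAt_zero, ← evalAt_one]
  rfl

end InfHomotopy

end Integration

/-! ### From 2-term homotopies to infinity homotopies -/

section Curve

variable {K V₀ V₁ W₀ W₁ : Type*} [Field K]
  [AddCommGroup V₀] [Module K V₀] [AddCommGroup V₁] [Module K V₁]
  [AddCommGroup W₀] [Module K W₀] [AddCommGroup W₁] [Module K W₁]
  {V : TwoTermLeibniz K V₀ V₁} {W : TwoTermLeibniz K W₀ W₁}

namespace InfMorphism

variable (f : InfMorphism V W) (θ : V₀ →ₗ[K] W₁)

/-- The form `t ↦ f^{tθ} + θ dt`, where `f^θ` is the target of the 2-term homotopy with source `f`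
and parameter `θ`; the components of `f^{tθ}` are polynomials of degree at most `2` in `t`. -/
def gaugeForm : LForms K V₀ V₁ W₀ W₁ :=
  f.toL ⊗ₜ TrivSqZeroExt.inl 1
    + ofComponents (W.l₁ ∘ₗ θ) (θ ∘ₗ V.l₁)
      (V.l₂.compr₂ θ - W.l₂r.compl₁₂ f.f₁₀ θ - W.l₂l.compl₁₂ θ f.f₁₀) ⊗ₜ
        TrivSqZeroExt.inl Polynomial.X
    + ofComponents 0 0 (-W.l₂l.compl₁₂ θ (W.l₁ ∘ₗ θ)) ⊗ₜ TrivSqZeroExt.inl (Polynomial.X ^ 2)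
    + ofParam θ ⊗ₜ TrivSqZeroExt.inr 1

theorem coeffAt_gaugeForm (t : K) : coeffAt t (f.gaugeForm θ) = ofParam θ := by
  simp [gaugeForm, coeffAt_tmul]

theorem homotopyParam_gaugeForm (i : Fin 2) : homotopyParam i (f.gaugeForm θ) = θ := by
  simp [homotopyParam_eq, gaugeForm, homotopyOp_tmul, valAt_tmul, formH, primitive_one,
    param_ofParam, sub_smul]

section Infinite

variable [Infinite K]

theorem gaugeForm_mem : f.gaugeForm θ ∈ totDeg K V₀ V₁ W₀ W₁ (-1) :=
  Submodule.add_mem _ (Submodule.add_mem _ (Submodule.add_mem _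
    (tmul_inl_mem_totDeg f.toL_mem _)
    (tmul_inl_mem_totDeg (ofComponents_mem _ _ _) _))
    (tmul_inl_mem_totDeg (ofComponents_mem _ _ _) _))
    (tmul_inr_mem_totDeg (by simpa using ofParam_mem θ) _)

theorem valAt_gaugeForm (t : K) : valAt t (f.gaugeForm θ) = (f.transport (t • θ)).toL := by
  refine convDeg_neg_one_ext (valAt_mem (f.gaugeForm_mem θ) t) (ofComponents_mem _ _ _)
    (fun x => ?_) (fun h => ?_) fun x y => ?_
  · simp [gaugeForm, valAt_tmul, toL_eq, transport, ofComponents_ι]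
  · simp [gaugeForm, valAt_tmul, toL_eq, transport, ofComponents_ι]
  · simp only [gaugeForm, toL_eq, TrivSqZeroExt.inl_one, DualNumber.inr_eq_smul_eps, one_smul,
      map_add, valAt_tmul, TrivSqZeroExt.fst_one, Polynomial.eval_one, TrivSqZeroExt.fst_inl,
      Polynomial.eval_X, Polynomial.eval_pow, DualNumber.fst_eps, Polynomial.eval_zero, zero_smul,
      add_zero, LinearMap.add_apply, ofComponents_ι_mul_ι, LinearMap.smul_apply,
      LinearMap.sub_apply, LinearMap.compr₂_apply, LinearMap.compl₁₂_apply, Prod.smul_mk, smul_zero,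
      Prod.mk_add_mk, LinearMap.neg_apply, LinearMap.coe_comp, Function.comp_apply, smul_neg,
      transport, map_smul, LinearMap.coe_smul, Pi.smul_apply]
    module

end Infinite

variable [CharZero K]

theorem derivAt_gaugeForm (t : K) :
    derivAt t (f.gaugeForm θ) = twistedDiff V W (f.transport (t • θ)).toL (ofParam θ) := by
  have h : derivAt t (f.gaugeForm θ) = ofComponents (W.l₁ ∘ₗ θ) (θ ∘ₗ V.l₁)
      (V.l₂.compr₂ θ - W.l₂r.compl₁₂ f.f₁₀ θ - W.l₂l.compl₁₂ θ f.f₁₀)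
      + (2 * t) • ofComponents 0 0 (-W.l₂l.compl₁₂ θ (W.l₁ ∘ₗ θ)) := by
    simp [gaugeForm, derivAt_tmul, one_add_one_eq_two]
  rw [h, toL_eq, twistedDiff_ofComponents_ofParam]
  refine convDeg_neg_one_ext
    (add_mem (ofComponents_mem _ _ _) (Submodule.smul_mem _ _ (ofComponents_mem _ _ _)))
    (ofComponents_mem _ _ _) (fun x => ?_) (fun h => ?_) fun x y => ?_
  · simp [ofComponents_ι]
  · simp [ofComponents_ι]
  · simp only [LinearMap.add_apply, ofComponents_ι_mul_ι, LinearMap.sub_apply,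
      LinearMap.compr₂_apply, LinearMap.compl₁₂_apply, LinearMap.smul_apply, LinearMap.neg_apply,
      LinearMap.coe_comp, Function.comp_apply, Prod.smul_mk, smul_zero, smul_neg, Prod.mk_add_mk,
      add_zero, transport, LinearMap.coe_smul, Pi.smul_apply, map_smul, map_add, W.rel_b]
    module

theorem curvature_gaugeForm : curvature V W (f.gaugeForm θ) = 0 :=
  eq_zero_of_valAt_of_coeffAt
    (fun t => by rw [valAt_curvature, valAt_gaugeForm, convCurvature_toL])
    (fun t => by
      rw [coeffAt_curvature, valAt_gaugeForm, coeffAt_gaugeForm, derivAt_gaugeForm, sub_self])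

/-- The infinity homotopy `t ↦ f^{tθ} + θ dt` with source `f`. -/
def infHomotopy : InfHomotopy V W where
  α := f.gaugeForm θ
  degree := f.gaugeForm_mem θ
  maurerCartan := f.curvature_gaugeForm θ

theorem morphismAt_infHomotopy (t : K) :
    (f.infHomotopy θ).morphismAt t = f.transport (t • θ) :=
  toL_injective (((f.infHomotopy θ).toL_morphismAt t).trans (f.valAt_gaugeForm θ t))

end InfMorphism

end Curve

section Correspondence

variable {K V₀ V₁ W₀ W₁ : Type*} [Field K] [CharZero K]
  [AddCommGroup V₀] [Module K V₀] [AddCommGroup V₁] [Module K V₁]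
  [AddCommGroup W₀] [Module K W₀] [AddCommGroup W₁] [Module K W₁]
  {V : TwoTermLeibniz K V₀ V₁} {W : TwoTermLeibniz K W₀ W₁}

/-- The 2-term homotopy `S₁ⁱ α` given by an infinity homotopy `α`. -/
def InfHomotopy.toTwoTerm (i : Fin 2) (α : InfHomotopy V W) : TwoTermHomotopy V W :=
  (α.morphismAt 0).homotopy (homotopyParam i α.α)

theorem InfHomotopy.mem_infHomotopies_toTwoTerm (i : Fin 2) (α : InfHomotopy V W) :
    α ∈ infHomotopies (α.toTwoTerm i).f (α.toTwoTerm i).g :=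
  α.mem_infHomotopies_iff.2 ⟨rfl, α.morphismAt_one i⟩

theorem InfMorphism.toTwoTerm_infHomotopy (i : Fin 2) (f : InfMorphism V W) (θ : V₀ →ₗ[K] W₁) :
    (f.infHomotopy θ).toTwoTerm i = f.homotopy θ := by
  rw [InfHomotopy.toTwoTerm, morphismAt_infHomotopy, zero_smul, transport_zero]
  exact congrArg f.homotopy (f.homotopyParam_gaugeForm θ i)

theorem InfHomotopy.toTwoTerm_surjective (i : Fin 2) :
    Function.Surjective (toTwoTerm i : InfHomotopy V W → TwoTermHomotopy V W) := fun T =>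
  ⟨T.f.infHomotopy T.θ, (T.f.toTwoTerm_infHomotopy i T.θ).trans T.eq_homotopy.symm⟩

end Correspondence

end

end LeibInf

theorem mainTheorem1 {K V₀ V₁ W₀ W₁ : Type*} [Field K] [CharZero K]
    [AddCommGroup V₀] [Module K V₀] [AddCommGroup V₁] [Module K V₁]
    [AddCommGroup W₀] [Module K W₀] [AddCommGroup W₁] [Module K W₁]
    (V : LeibInf.TwoTermLeibniz K V₀ V₁) (W : LeibInf.TwoTermLeibniz K W₀ W₁) (i : Fin 2) :
    ∃ S : LeibInf.InfHomotopy V W → LeibInf.TwoTermHomotopy V W,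
      (∀ a, (S a).θ = LeibInf.homotopyParam i a.α) ∧
      (∀ a, a ∈ LeibInf.infHomotopies (S a).f (S a).g) ∧
      Function.Surjective S ∧
      ∀ f g : LeibInf.InfMorphism V W,
        Set.MapsTo S (LeibInf.infHomotopies f g) (LeibInf.twoTermHomotopies f g) ∧
        Set.SurjOn S (LeibInf.infHomotopies f g) (LeibInf.twoTermHomotopies f g) := by
  have hmem (a : LeibInf.InfHomotopy V W) := a.mem_infHomotopies_toTwoTerm i
  have hsurj : Function.Surjective (LeibInf.InfHomotopy.toTwoTerm (V := V) (W := W) i) :=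
    LeibInf.InfHomotopy.toTwoTerm_surjective i
  refine ⟨_, fun _ => rfl, hmem, hsurj, fun f g => ⟨fun a ha => ?_, ?_⟩⟩
  · obtain ⟨h₀, h₁⟩ := a.mem_infHomotopies_iff.1 ha
    exact ⟨h₀, (a.morphismAt_one i).symm.trans h₁⟩
  · rintro T ⟨rfl, rfl⟩
    obtain ⟨a, rfl⟩ := hsurj T
    exact ⟨a, hmem a, rfl⟩
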